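/- Let $X_1,X_2,\dots$ be i.i.d. standard exponential random variables, $S_i=X_1+\dots+X_i$ and $Y_k=\frac{2}{k(k+1)}\sum_{i=1}^k S_i$. For $t\ge 0$ and $n\ge 1$ put $$G_n(t)=\mathbb P\Bigl\{\min_{1\le k\le n}Y_k\ge t\Bigr\},\qquad G(t)=\mathbb P\Bigl\{\inf_{k\ge 1}Y_k\ge t\Bigr\}.$$ Let $l_j=\frac{j(j+1)}2$. For $k\ge 1$ let $L_k$ be the $k\times k$ matrix whose $j$-th column has the entries $l_j,-2l_j,l_j$ in the rows $j,j+1,j+2$ (as far as these rows exist) and zeros elsewhere; it is the inverse of the matrix $A_k$ determined by $(Y_1,\dots,Y_k)^\top=A_k(X_1,\dots,X_k)^\top$. Let $M_k$ be the $k\times(k-1)$ matrix obtained from $L_k$ by deleting the last column, let $$P_k=\{\mathbf y\in\mathbb R^{k-1}: M_k\mathbf y\ge-\mathbf 1,\ \mathbf y\ge\mathbf 0\}$$ (inequalities coordinatewise; $P_1$ is the one-point space $\mathbb R^0$, of volume $1$), and let $$c_k=2^{-k}\,k!\,(k+1)!\,\mathrm{vol}_{k-1}(P_k),\qquad k\ge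 1 .$$ Then the $c_k$ are positive and finite, $c_k=O(\sqrt k\,e^k)$ as $k\to\infty$, and the following hold, where derivatives at $t=0$ are right derivatives. 1. Every $G_n$, $n\ge1$, is continuously differentiable on $[0,\infty)$. 2. The series $\sum_{k\ge1}c_k(te^{-t})^{k-1}$ converges for every $t\in[0,1)$, and for every $\varepsilon\in(0,1)$ the derivatives $G_n'(t)$ converge, as $n\to\infty$, to $-G(t)e^{-t}\sum_{k=1}^\infty c_k(te^{-t})^{k-1}$ uniformly on $[0,1-\varepsilon]$. 3. $G$ is continuously differentiable on $[0,1)$, and $$G'(t)=-G(t)e^{-t}\sum_{k=1}^\infty c_k\bigl(te^{-t}\bigr)^{k-1},\qquad t\in[0,1).$$ -/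

import Mathlib

open MeasureTheory ProbabilityTheory Filter Asymptotics
open scoped Matrix Nat

namespace ExpArea

noncomputable section

/-- The random walk `S_k = X_1 + ... + X_k`; the increment `X_{i+1}` is `X i`. -/
def S {Ω : Type*} (X : ℕ → Ω → ℝ) (k : ℕ) (ω : Ω) : ℝ :=
  ∑ i ∈ Finset.range k, X i ω

/-- The normalized `k`-step area `Y_k = 2 / (k (k + 1)) * (S_1 + ... + S_k)`, for `k ≥ 1`. -/
def Y {Ω : Type*} (X : ℕ → Ω → ℝ) (k : ℕ) (ω : Ω) : ℝ :=
  2 / ((k : ℝ) * (k + 1)) * ∑ i ∈ Finset.Icc 1 k, S X i ω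

/-- `G_n(t) = P {min_{1 ≤ k ≤ n} Y_k ≥ t}`. -/
def Gn {Ω : Type*} [MeasurableSpace Ω] (P : Measure Ω) (X : ℕ → Ω → ℝ) (n : ℕ) (t : ℝ) : ℝ :=
  P.real {ω | (t : EReal) ≤ ⨅ k ∈ Finset.Icc 1 n, (Y X k ω : EReal)}

/-- `G(t) = P {inf_{k ≥ 1} Y_k ≥ t}`; the infimum is taken in the extended reals. -/
def G {Ω : Type*} [MeasurableSpace Ω] (P : Measure Ω) (X : ℕ → Ω → ℝ) (t : ℝ) : ℝ :=
  P.real {ω | (t : EReal) ≤ ⨅ k ∈ Set.Ici 1, (Y X k ω : EReal)}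

/-- The triangular numbers `l_k = k (k + 1) / 2`. -/
def l (k : ℕ) : ℝ := (k : ℝ) * (k + 1) / 2

/-- The matrix `A_n` with `(Y_1, ..., Y_n) = A_n (X_1, ..., X_n)`; indices start at `0`. -/
def A (n : ℕ) : Matrix (Fin n) (Fin n) ℝ := Matrix.of fun i j =>
  if (j : ℕ) ≤ i then 2 * ((i : ℝ) + 1 - j) / (((i : ℝ) + 1) * (i + 2)) else 0

/-- The inverse `L_n` of `A_n` (see `L_mul_A`), written out: its `j`th column is
`l_j, -2 l_j, l_j` in the rows `j, j + 1, j + 2` (counted from `1`), and `0` elsewhere. -/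
def L (n : ℕ) : Matrix (Fin n) (Fin n) ℝ := Matrix.of fun i j =>
  if (i : ℕ) = j then l (j + 1)
  else if (i : ℕ) = j + 1 then -2 * l (j + 1)
  else if (i : ℕ) = j + 2 then l (j + 1)
  else 0

/-- The polytope `P_{k+1}` in `ℝ^k`: all `y ≥ 0` such that `M y ≥ -1`, where `M` is the
`(k + 1) × k` matrix obtained from `L_{k+1}` by deleting its last column. -/
def polytope (k : ℕ) : Set (Fin k → ℝ) :=
  {y | -1 ≤ (L (k + 1)).submatrix id Fin.castSucc *ᵥ y ∧ 0 ≤ y}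

/-- `c_k = 2^{-k} k! (k + 1)! vol(P_k)` for `k ≥ 1` (the value at `0` is not used). -/
def c : ℕ → ℝ
  | 0 => 0
  | k + 1 => (k + 1)! * (k + 2)! / 2 ^ (k + 1) * volume.real (polytope k)

/-- `-G(t) e^{-t} ∑_{k ≥ 1} c_k (t e^{-t})^{k-1}`. -/
def rhs {Ω : Type*} [MeasurableSpace Ω] (P : Measure Ω) (X : ℕ → Ω → ℝ) (t : ℝ) : ℝ :=
  -G P X t * Real.exp (-t) * ∑' k : ℕ, c (k + 1) * (t * Real.exp (-t)) ^ k

theorem l_mul_A {n : ℕ} (i j : Fin n) :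
    l (i + 1) * A n i j = if (j : ℕ) ≤ i then (i : ℝ) + 1 - j else 0 := by
  simp only [A, l, Matrix.of_apply]
  split_ifs
  · push_cast; field_simp; ring
  · simp

theorem L_mul_A (n : ℕ) : L n * A n = 1 := by
  ext i j
  rw [Matrix.mul_apply]
  have key : ∀ m : Fin n, L n i m * A n m j =
      (if (m : ℕ) = i then (if (j : ℕ) ≤ m then (m : ℝ) + 1 - j else 0) else 0)
      + (if (m : ℕ) + 1 = i then -2 * (if (j : ℕ) ≤ m then (m : ℝ) + 1 - j else 0) else 0)
      + (if (m : ℕ) + 2 = i then (if (j : ℕ) ≤ m then (m : ℝ) + 1 - j else 0) else 0) := by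
    intro m
    rw [← l_mul_A m j]
    simp only [L, Matrix.of_apply]
    split_ifs <;> first | omega | ring
  rw [Finset.sum_congr rfl fun m _ => key m]
  obtain ⟨i, hi⟩ := i
  obtain ⟨j, hj⟩ := j
  rw [Fin.sum_univ_eq_sum_range (fun m : ℕ =>
      (if m = i then (if j ≤ m then (m : ℝ) + 1 - j else 0) else 0)
      + (if m + 1 = i then -2 * (if j ≤ m then (m : ℝ) + 1 - j else 0) else 0)
      + (if m + 2 = i then (if j ≤ m then (m : ℝ) + 1 - j else 0) else 0)) n,
    Matrix.one_apply, Finset.sum_add_distrib, Finset.sum_add_distrib]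
  simp only [Fin.mk.injEq]
  rcases i with _ | _ | i
  · simp [Finset.sum_ite_eq', show 0 < n by omega]
    by_cases h : j = 0
    · simp [h]
    · simp [h, Ne.symm h]
  · simp [Finset.sum_ite_eq', show 0 < n by omega, show 1 < n by omega]
    rcases j with _ | _ | j <;> simp
    norm_num
  · simp only [Nat.add_right_cancel_iff, show ∀ m : ℕ, (m + 1 = i + 1 + 1) = (m = i + 1) by
      intro m; simp]
    simp only [Finset.sum_ite_eq', Finset.mem_range, show i < n by omega,
      show i + 1 < n by omega, show i + 1 + 1 < n by omega, if_true]
    push_cast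
    rcases lt_trichotomy j (i + 1) with h | h | h
    · rw [if_pos (by omega), if_pos (by omega), if_pos (by omega), if_neg (by omega)]; ring
    · subst h
      rw [if_pos (by omega), if_pos (by omega), if_neg (by omega), if_neg (by omega)]
      push_cast; ring
    · rw [if_neg (show ¬ j ≤ i + 1 by omega), if_neg (show ¬ j ≤ i by omega)]
      rcases Nat.lt_or_ge (i + 2) j with h' | h'
      · rw [if_neg (by omega), if_neg (by omega)]; ring
      · obtain rfl : j = i + 2 := by omega
        simp; ring

theorem L_eq_inv (n : ℕ) : L n = (A n)⁻¹ :=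
  (Matrix.inv_eq_left_inv (L_mul_A n)).symm

theorem c_one : c 1 = 1 := by
  have h : polytope 0 = Set.univ := by
    ext y
    simp only [polytope, Set.mem_ofPred_eq, Set.mem_univ, iff_true]
    refine ⟨fun i => ?_, fun i => i.elim0⟩
    simp [Matrix.mulVec, dotProduct]
  have hv : volume.real (Set.univ : Set (Fin 0 → ℝ)) = 1 := by
    rw [Measure.real, Measure.volume_pi_eq_dirac]
    simp
  simp [c, h, hv]

end

end ExpArea

namespace ExpArea

noncomputable section

open scoped ENNReal Topology

/-! ### Second differences and double partial sums -/

/-! The complement of $\{\min_{k\le n}Y_k\ge t\}$ is split by the index $k$ of the first minimum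
(`Gn_add_sum_firstMin`), and each piece is integrated over the value $s=Y_k$. Throughout, $p=k-1$.

Given $k$ and $s$, the first $k$ increments are `bridge u + s • 1`, where $u_j=l_j(Y_j-s)>0$ for
$j<k$. Their sum is $ks$ minus the last entry $a$ of $u$, so their density is $e^{a-ks}$. Relative
to level $s$, the future starts with area $0$ at position $-a$ (`lintegral_survival`,
`measure_firstMin`). If $k<n$, the next increment has to be at least $s+a$; by lack of memory this
costs $e^{-a}$ and leaves a fresh walk (`survival_neg`). The two exponentials cancel, so the past
enters only through the volume of the slice of admissible $u$, which by homogeneity is $s^{k-1}$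
times a fixed volume. With the Jacobian $l_k$ this yields $c_k$ (`c_succ`), and the piece has
probability $\int_0^t c_ks^{k-1}e^{-ks}G_{n-k}(s)\,ds$ (`measure_firstMin_succ`). For $k=n$ there is
no next increment and the factor $e^{a}$ stays (`lastDensity`). The resulting integral equation for
$G_n$ involves only earlier $G_m$, and an induction gives continuous differentiability
(`continuousOn_Gn`).

As $n\to\infty$ three estimates let the limit pass through the sum, uniformly on $[0,b]$ with $b<1$
(`exists_bound_negDeriv`): $c_k=O(\sqrt k\,e^k)$ with $te^{-t}<e^{-1}$ gives a summable majorant; a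
Chernoff bound with a union bound gives $G_n\to G$ uniformly; and the last density is compared with
$P(Y_n\le t+2/(n+1))$, which is exponentially small (`lastDensity_le`). The first and the third come
from one trick: thicken a slice to a slab by moving the first increment (`slice_le_lintegral`). The
limit of the integral equations then identifies $G'$ (`G_eq_integral`). -/

/-- The matrix of second differences: `x = E T` when `T` is the double partial sum of `x`. -/
def E (n : ℕ) : Matrix (Fin n) (Fin n) ℝ := Matrix.of fun i j =>
  if (i : ℕ) = j then 1
  else if (i : ℕ) = j + 1 then -2
  else if (i : ℕ) = j + 2 then 1
  else 0

/-- The double partial sum `∑_{i < j} (j - i) x_i`. -/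
def area {n : ℕ} (x : Fin n → ℝ) (j : ℕ) : ℝ := ∑ i : Fin n, ((j - (i : ℕ) : ℕ) : ℝ) * x i

theorem l_pos (k : ℕ) : 0 < l (k + 1) := by
  unfold l; positivity

/-- The substitution $u_j=l_jy_j$ removes the weights from `L`; what remains is unimodular. -/
theorem L_eq_E_mul (n : ℕ) : L n = E n * Matrix.diagonal fun j : Fin n => l (j + 1) := by
  ext i j
  rw [Matrix.mul_diagonal]
  simp only [L, E, Matrix.of_apply]
  split_ifs <;> ring

theorem E_mul_area_matrix (n : ℕ) :
    E n * Matrix.of (fun i j : Fin n => (((i : ℕ) + 1 - (j : ℕ) : ℕ) : ℝ)) = 1 := by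
  have h : Matrix.of (fun i j : Fin n => (((i : ℕ) + 1 - (j : ℕ) : ℕ) : ℝ)) =
      (Matrix.diagonal fun j : Fin n => l (j + 1)) * A n := by
    ext i j
    rw [Matrix.diagonal_mul, l_mul_A, Matrix.of_apply]
    split_ifs with h
    · rw [Nat.cast_sub (by omega)]; push_cast; ring
    · rw [Nat.sub_eq_zero_of_le (by omega)]; simp
  rw [h, ← Matrix.mul_assoc, ← L_eq_E_mul, L_mul_A]

theorem area_E_mulVec {n : ℕ} (T : Fin n → ℝ) (j : Fin n) :
    area (E n *ᵥ T) (j + 1) = T j := by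
  have h := mul_eq_one_comm.1 (E_mul_area_matrix n)
  have h2 := congrFun (congrArg (fun M => M *ᵥ T) h) j
  simp only [← Matrix.mulVec_mulVec, Matrix.one_mulVec] at h2
  rw [← h2]
  rfl

theorem E_mulVec_area {n : ℕ} (x : Fin n → ℝ) :
    E n *ᵥ (fun j : Fin n => area x (j + 1)) = x := by
  have h2 := congrArg (fun M => M *ᵥ x) (E_mul_area_matrix n)
  simp only [← Matrix.mulVec_mulVec, Matrix.one_mulVec] at h2
  exact h2

theorem det_E (n : ℕ) : (E n).det = 1 := by
  rw [Matrix.det_of_isLowerTriangular]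
  · simp [E]
  · intro i j hij
    have : (i : ℕ) < j := hij
    simp only [E, Matrix.of_apply]
    rw [if_neg (by omega), if_neg (by omega), if_neg (by omega)]

theorem area_zero {n : ℕ} (x : Fin n → ℝ) : area x 0 = 0 := by simp [area]

theorem sum_eq_area_sub {n : ℕ} (x : Fin (n + 1) → ℝ) :
    ∑ i, x i = area x (n + 1) - area x n := by
  rw [area, area, ← Finset.sum_sub_distrib]
  refine Finset.sum_congr rfl fun i _ => ?_
  have : (n + 1 - (i : ℕ) : ℕ) = (n - (i : ℕ)) + 1 := by omega
  rw [this]; push_cast; ring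

theorem area_const_one {n j : ℕ} (h : j ≤ n) : area (1 : Fin n → ℝ) j = l j := by
  simp only [area, Pi.one_apply, mul_one]
  rw [Fin.sum_univ_eq_sum_range (fun i : ℕ => ((j - i : ℕ) : ℝ)) n]
  induction j with
  | zero => simp [l]
  | succ j ih =>
    -- The number of terms stays `n` while `j` grows: splitting off the first term shifts the rest,
    -- and the term added to restore the range is zero by truncated subtraction.
    rw [← Nat.sub_add_cancel (show 1 ≤ n by omega), Finset.sum_range_succ']
    have h1 : ∑ k ∈ Finset.range (n - 1), ((j + 1 - (k + 1) : ℕ) : ℝ) =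
        ∑ k ∈ Finset.range n, ((j - k : ℕ) : ℝ) := by
      conv_rhs => rw [← Nat.sub_add_cancel (show 1 ≤ n by omega), Finset.sum_range_succ]
      rw [Nat.sub_eq_zero_of_le (show j ≤ n - 1 by omega)]
      simp
    rw [h1, ih (by omega)]
    simp [l]; ring

theorem area_single {n j : ℕ} : area (Pi.single 0 1 : Fin (n + 1) → ℝ) j = j := by
  simp [area, Pi.single_apply]

theorem E_mulVec_l (n : ℕ) : E n *ᵥ (fun j : Fin n => l (j + 1)) = 1 := by
  have := E_mulVec_area (1 : Fin n → ℝ)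
  rwa [show (fun j : Fin n => area (1 : Fin n → ℝ) (j + 1)) = fun j : Fin n => l (j + 1) from
    funext fun j => area_const_one (by omega)] at this

theorem E_mulVec_succ (n : ℕ) :
    E (n + 1) *ᵥ (fun j : Fin (n + 1) => (j : ℝ) + 1) = Pi.single 0 1 := by
  have := E_mulVec_area (Pi.single 0 1 : Fin (n + 1) → ℝ)
  simpa [area_single] using this

theorem area_add {n : ℕ} (x y : Fin n → ℝ) (j : ℕ) : area (x + y) j = area x j + area y j := by
  simp [area, mul_add, Finset.sum_add_distrib]

theorem area_smul {n : ℕ} (r : ℝ) (x : Fin n → ℝ) (j : ℕ) : area (r • x) j = r * area x j := by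
  simp only [area, Finset.mul_sum, Pi.smul_apply, smul_eq_mul]
  exact Finset.sum_congr rfl fun i _ => by ring

theorem area_nonneg {n : ℕ} {x : Fin n → ℝ} (hx : 0 ≤ x) (j : ℕ) : 0 ≤ area x j :=
  Finset.sum_nonneg fun i _ => mul_nonneg (Nat.cast_nonneg _) (hx i)

theorem continuous_area {n : ℕ} (j : ℕ) : Continuous fun x : Fin n → ℝ => area x j := by
  unfold area; fun_prop

/-- The second differences of `u` prolonged by a final `0`. -/
def bridge {p : ℕ} (u : Fin p → ℝ) : Fin (p + 1) → ℝ :=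
  E (p + 1) *ᵥ (Fin.snoc u 0 : Fin (p + 1) → ℝ)

theorem snoc_zero_smul {p : ℕ} (r : ℝ) (u : Fin p → ℝ) :
    (Fin.snoc (r • u) 0 : Fin (p + 1) → ℝ) = r • (Fin.snoc u 0 : Fin (p + 1) → ℝ) := by
  ext i; refine Fin.lastCases ?_ (fun i => ?_) i <;> simp

theorem bridge_smul {p : ℕ} (r : ℝ) (u : Fin p → ℝ) : bridge (r • u) = r • bridge u := by
  rw [bridge, snoc_zero_smul, Matrix.mulVec_smul, bridge]

theorem continuous_snoc_zero (p : ℕ) :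
    Continuous fun u : Fin p → ℝ => (Fin.snoc u 0 : Fin (p + 1) → ℝ) := by
  refine continuous_pi fun i => ?_
  refine Fin.lastCases ?_ (fun i => ?_) i
  · simpa using continuous_const
  · simpa using continuous_apply i

theorem continuous_bridge (p : ℕ) : Continuous (bridge : (Fin p → ℝ) → _) :=
  Continuous.matrix_mulVec continuous_const (continuous_snoc_zero p)

theorem area_bridge {p : ℕ} (u : Fin p → ℝ) (j : Fin p) : area (bridge u) (j + 1) = u j := by
  have := area_E_mulVec (Fin.snoc u 0 : Fin (p + 1) → ℝ) j.castSucc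
  simpa [bridge] using this

theorem area_bridge_last {p : ℕ} (u : Fin p → ℝ) : area (bridge u) (p + 1) = 0 := by
  have := area_E_mulVec (Fin.snoc u 0 : Fin (p + 1) → ℝ) (Fin.last p)
  simpa [bridge] using this

/-- The last entry of `u` (zero if there is none). -/
def lastEntry {p : ℕ} (u : Fin p → ℝ) : ℝ := area (bridge u) p

theorem sum_bridge {p : ℕ} (u : Fin p → ℝ) : ∑ i, bridge u i = -lastEntry u := by
  rw [sum_eq_area_sub, area_bridge_last, lastEntry]; ring

theorem lastEntry_nonneg {p : ℕ} {u : Fin p → ℝ} (hu : 0 ≤ u) : 0 ≤ lastEntry u := by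
  rcases p with _ | p
  · simp [lastEntry, area_zero]
  · have := area_bridge u (Fin.last p)
    rw [lastEntry]
    simp only [Fin.val_last] at this
    rw [this]; exact hu _

theorem lastEntry_smul {p : ℕ} (r : ℝ) (u : Fin p → ℝ) :
    lastEntry (r • u) = r * lastEntry u := by
  rw [lastEntry, bridge_smul, area_smul, lastEntry]

theorem continuous_lastEntry (p : ℕ) : Continuous (lastEntry : (Fin p → ℝ) → ℝ) :=
  (continuous_area p).comp (continuous_bridge p)

/-! ### Slicing integrals -/

/-- Since `E` has determinant $1$, double partial sums may replace increments as coordinates at no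
cost. -/
theorem lintegral_E_mulVec {n : ℕ} {H : (Fin n → ℝ) → ℝ≥0∞} (hH : Measurable H) :
    ∫⁻ T, H (E n *ᵥ T) = ∫⁻ x, H x := by
  have h := Real.map_matrix_volume_pi_eq_smul_volume_pi (M := E n) (by rw [det_E]; exact one_ne_zero)
  rw [det_E] at h
  simp only [inv_one, abs_one, ENNReal.ofReal_one, one_smul] at h
  have hm : Measurable (Matrix.toLin' (E n)) := (LinearMap.continuous_on_pi _).measurable
  conv_rhs => rw [← h]
  rw [lintegral_map hH hm]
  simp

theorem measurable_snoc (p : ℕ) :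
    Measurable fun q : ℝ × (Fin p → ℝ) => (Fin.snoc q.2 q.1 : Fin (p + 1) → ℝ) := by
  refine measurable_pi_lambda _ fun i => ?_
  refine Fin.lastCases ?_ (fun i => ?_) i
  · simpa using measurable_fst
  · simp only [Fin.snoc_castSucc]
    exact (measurable_pi_apply i).comp measurable_snd

theorem lintegral_snoc {p : ℕ} {H : (Fin (p + 1) → ℝ) → ℝ≥0∞} (hH : Measurable H) :
    ∫⁻ T, H T = ∫⁻ τ : ℝ, ∫⁻ u : Fin p → ℝ, H (Fin.snoc u τ) := by
  have h := (volume_preserving_piFinSuccAbove (fun _ : Fin (p + 1) => ℝ) (Fin.last p)).symm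
  rw [← h.lintegral_comp hH, Measure.volume_eq_prod, lintegral_prod]
  · refine lintegral_congr fun τ => lintegral_congr fun u => ?_
    congr 1
    simp [MeasurableEquiv.piFinSuccAbove, Fin.insertNthEquiv]
  · exact (hH.comp h.measurable).aemeasurable

theorem lintegral_comp_mul_left_of_pos {f : ℝ → ℝ≥0∞} {a : ℝ} (ha : 0 < a) (hf : Measurable f) :
    ENNReal.ofReal a * ∫⁻ θ, f (a * θ) = ∫⁻ τ, f τ := by
  have h := Real.smul_map_volume_mul_left ha.ne'
  conv_rhs => rw [← h]
  rw [lintegral_smul_measure, lintegral_map hf (measurable_const_mul a), abs_of_pos ha, smul_eq_mul]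

/-- In double-partial-sum coordinates write $T=(u,0)+\theta w$. The last coordinate is $\theta
w_{\rm last}$, which gives the Jacobian, and for fixed $\theta$ the other coordinates are only
translated. -/
theorem lintegral_slices {p : ℕ} {H : (Fin (p + 1) → ℝ) → ℝ≥0∞} (hH : Measurable H)
    (w : Fin (p + 1) → ℝ) (hw : 0 < w (Fin.last p)) :
    ∫⁻ x, H x = ENNReal.ofReal (w (Fin.last p)) *
      ∫⁻ θ : ℝ, ∫⁻ u : Fin p → ℝ, H (bridge u + θ • (E (p + 1) *ᵥ w)) := by
  have hE : Measurable fun T : Fin (p + 1) → ℝ => H (E (p + 1) *ᵥ T) :=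
    hH.comp (Continuous.matrix_mulVec continuous_const continuous_id).measurable
  rw [← lintegral_E_mulVec hH, lintegral_snoc hE, ← lintegral_comp_mul_left_of_pos hw]
  · congr 1
    refine lintegral_congr fun θ => ?_
    rw [← lintegral_add_right_eq_self _ (θ • fun i : Fin p => w i.castSucc)]
    refine lintegral_congr fun u => ?_
    rw [bridge, ← Matrix.mulVec_smul, ← Matrix.mulVec_add]
    congr 2
    ext i
    refine Fin.lastCases ?_ (fun i => ?_) i
    · simp [mul_comm]
    · simp
  · exact (hE.comp (measurable_snoc p)).lintegral_prod_right'

/-- Coordinates adapted to the slope `s` of the chord of the double partial sum. -/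
theorem lintegral_slices_l {p : ℕ} {H : (Fin (p + 1) → ℝ) → ℝ≥0∞} (hH : Measurable H) :
    ∫⁻ x, H x = ENNReal.ofReal (l (p + 1)) *
      ∫⁻ s : ℝ, ∫⁻ u : Fin p → ℝ, H (bridge u + s • 1) := by
  rw [lintegral_slices hH (fun j => l (j + 1)) (by simpa using l_pos p), E_mulVec_l]
  simp

/-- Slicing along the direction that changes the first increment alone; this serves to thicken
slices into slabs. -/
theorem lintegral_slices_single {p : ℕ} {H : (Fin (p + 1) → ℝ) → ℝ≥0∞} (hH : Measurable H) :
    ∫⁻ x, H x = ENNReal.ofReal (p + 1) *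
      ∫⁻ θ : ℝ, ∫⁻ u : Fin p → ℝ, H (bridge u + θ • Pi.single 0 1) := by
  rw [lintegral_slices hH (fun j => (j : ℝ) + 1) (by simp; positivity), E_mulVec_succ]
  simp

/-! ### The rescaled polytope -/

/-- The polytope `P_{p+1}` in the coordinates `u_j = l_j y_j`. -/
def bridgeSet (p : ℕ) : Set (Fin p → ℝ) := {u | 0 ≤ u ∧ -1 ≤ bridge u}

theorem measurableSet_bridgeSet (p : ℕ) : MeasurableSet (bridgeSet p) :=
  ((isClosed_le continuous_const continuous_id).inter
    (isClosed_le continuous_const (continuous_bridge p))).measurableSet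

theorem mem_polytope_iff {p : ℕ} (y : Fin p → ℝ) :
    y ∈ polytope p ↔ (fun j : Fin p => l (j + 1) * y j) ∈ bridgeSet p := by
  have h : (L (p + 1)).submatrix id Fin.castSucc *ᵥ y =
      bridge (fun j : Fin p => l (j + 1) * y j) := by
    ext i
    simp only [bridge, Matrix.mulVec, dotProduct, Fin.sum_univ_castSucc, Fin.snoc_castSucc,
      Fin.snoc_last, mul_zero, add_zero, Matrix.submatrix_apply, id]
    refine Finset.sum_congr rfl fun j _ => ?_
    rw [L_eq_E_mul, Matrix.mul_diagonal]
    simp [mul_assoc]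
  simp only [polytope, bridgeSet, Set.mem_ofPred_eq, h]
  rw [and_comm]
  refine and_congr ?_ Iff.rfl
  simp only [Pi.le_def, Pi.zero_apply]
  exact forall_congr' fun j => (mul_nonneg_iff_of_pos_left (l_pos _)).symm

theorem prod_l (k : ℕ) : ∏ j ∈ Finset.range k, l (j + 1) = k ! * (k + 1)! / 2 ^ k := by
  induction k with
  | zero => simp
  | succ k ih =>
    rw [Finset.prod_range_succ, ih, l, Nat.factorial_succ (k + 1), Nat.factorial_succ k]
    push_cast; field_simp; ring

/-- The prefactor of $c_k$ is $l_1\cdots l_k$. The first $k-1$ factors are the Jacobian of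
$u_j=l_jy_j$; the surviving $l_k$ is the one produced by `lintegral_slices_l`. -/
theorem c_succ (p : ℕ) : c (p + 1) = l (p + 1) * volume.real (bridgeSet p) := by
  have hdet : (Matrix.diagonal fun j : Fin p => l (j + 1)).det =
      ∏ j ∈ Finset.range p, l (j + 1) := by
    rw [Matrix.det_diagonal, Fin.prod_univ_eq_prod_range (fun j => l (j + 1)) p]
  have hpos : 0 < ∏ j ∈ Finset.range p, l (j + 1) := Finset.prod_pos fun j _ => l_pos j
  have h := Real.smul_map_diagonal_volume_pi (D := fun j : Fin p => l (j + 1))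
    (by rw [hdet]; exact hpos.ne')
  have hm : Measurable (Matrix.toLin' (Matrix.diagonal fun j : Fin p => l (j + 1))) :=
    (LinearMap.continuous_on_pi _).measurable
  have hv : volume.real (bridgeSet p) =
      (∏ j ∈ Finset.range p, l (j + 1)) * volume.real (polytope p) := by
    have h' : volume (bridgeSet p) = _ := (congrArg (fun μ => μ (bridgeSet p)) h).symm
    rw [Measure.real, Measure.real, h', Measure.smul_apply,
      Measure.map_apply hm (measurableSet_bridgeSet p), hdet, abs_of_pos hpos, smul_eq_mul,
      ENNReal.toReal_mul, ENNReal.toReal_ofReal hpos.le]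
    congr 3
    ext y
    rw [mem_polytope_iff]
    simp only [Set.mem_preimage, Matrix.toLin'_apply]
    rw [show Matrix.diagonal (fun j : Fin p => l (j + 1)) *ᵥ y =
        fun j : Fin p => l (j + 1) * y j from
      funext fun j => by rw [Matrix.mulVec_diagonal]]
  rw [hv, c, ← prod_l, Finset.prod_range_succ]
  ring

theorem lastEntry_le {p : ℕ} {u : Fin p → ℝ} (hu : u ∈ bridgeSet p) : lastEntry u ≤ p + 1 := by
  have h : ∑ i : Fin (p + 1), (-1 : ℝ) ≤ ∑ i, bridge u i := Finset.sum_le_sum fun i _ => hu.2 i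
  rw [sum_bridge] at h
  simp at h
  linarith

/-- A row of `E` has at most one negative entry, and it is $-2$, so coordinates in $[0,1/2]$ keep
all second differences above $-1$. -/
theorem volume_bridgeSet_pos (p : ℕ) : 0 < volume (bridgeSet p) := by
  have hsub : (Set.univ.pi fun _ : Fin p => Set.Icc (0 : ℝ) (1 / 2)) ⊆ bridgeSet p := by
    intro u hu
    have hu0 : ∀ j, 0 ≤ (Fin.snoc u 0 : Fin (p + 1) → ℝ) j := fun j => by
      refine Fin.lastCases ?_ (fun i => ?_) j
      · simp
      · simpa using (hu i trivial).1
    have hu1 : ∀ j, (Fin.snoc u 0 : Fin (p + 1) → ℝ) j ≤ 1 / 2 := fun j => by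
      refine Fin.lastCases ?_ (fun i => ?_) j
      · simp
      · simpa using (hu i trivial).2
    refine ⟨fun j => (hu j trivial).1, fun i => ?_⟩
    simp only [bridge, Matrix.mulVec, dotProduct, Pi.neg_apply, Pi.one_apply]
    have : ∀ j : Fin (p + 1), (if (j : ℕ) + 1 = i then -1 else 0 : ℝ) ≤
        E (p + 1) i j * (Fin.snoc u 0 : Fin (p + 1) → ℝ) j := by
      intro j
      simp only [E, Matrix.of_apply]
      have := hu0 j
      have := hu1 j
      split_ifs <;> first | omega | linarith
    refine le_trans ?_ (Finset.sum_le_sum fun j _ => this j)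
    rw [Finset.sum_ite, Finset.sum_const_zero, add_zero, Finset.sum_const, nsmul_eq_mul]
    have hc : (Finset.univ.filter fun j : Fin (p + 1) => (j : ℕ) + 1 = i).card ≤ 1 := by
      rw [Finset.card_le_one]
      intro a ha b hb
      simp only [Finset.mem_filter, Finset.mem_univ, true_and] at ha hb
      exact Fin.ext (by omega)
    have : ((Finset.univ.filter fun j : Fin (p + 1) => (j : ℕ) + 1 = i).card : ℝ) ≤ 1 := by
      exact_mod_cast hc
    linarith
  refine lt_of_lt_of_le ?_ (measure_mono hsub)
  rw [volume_pi_pi]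
  refine pos_iff_ne_zero.2 (Finset.prod_ne_zero_iff.2 fun i _ => ?_)
  simp

/-- Homogeneity: `bridge` is linear, so the slice at height $s>0$ is $s$ times `bridgeSet p`. -/
theorem lintegral_smul_bridgeSet {p : ℕ} {s : ℝ} (hs : 0 < s) {f : (Fin p → ℝ) → ℝ≥0∞}
    (hf : Measurable f) :
    ∫⁻ u, {u : Fin p → ℝ | 0 ≤ u ∧ 0 ≤ bridge u + s • 1}.indicator f u =
      ENNReal.ofReal (s ^ p) * ∫⁻ z in bridgeSet p, f (s • z) := by
  have hV : MeasurableSet {u : Fin p → ℝ | 0 ≤ u ∧ 0 ≤ bridge u + s • 1} :=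
    ((isClosed_le continuous_const continuous_id).inter
      (isClosed_le continuous_const ((continuous_bridge p).add continuous_const))).measurableSet
  have h := Measure.map_addHaar_smul (volume : Measure (Fin p → ℝ)) hs.ne'
  rw [Module.finrank_fin_fun, abs_of_pos (by positivity)] at h
  have hsp : (volume : Measure (Fin p → ℝ)) =
      ENNReal.ofReal (s ^ p) • Measure.map (s • ·) volume := by
    rw [h, smul_smul, ← ENNReal.ofReal_mul (by positivity), mul_inv_cancel₀ (by positivity)]
    simp
  conv_lhs => rw [hsp]
  rw [lintegral_smul_measure, lintegral_map (hf.indicator hV) (measurable_const_smul s),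
    smul_eq_mul, ← lintegral_indicator (measurableSet_bridgeSet p)]
  congr 1
  refine lintegral_congr fun z => ?_
  have : (s • z ∈ {u : Fin p → ℝ | 0 ≤ u ∧ 0 ≤ bridge u + s • 1}) ↔ z ∈ bridgeSet p := by
    simp only [Set.mem_ofPred_eq, bridgeSet, bridge_smul, Pi.le_def, Pi.smul_apply,
      Pi.zero_apply, smul_eq_mul, mul_nonneg_iff_of_pos_left hs, Pi.add_apply, Pi.neg_apply,
      Pi.one_apply]
    refine and_congr Iff.rfl (forall_congr' fun i => ?_)
    rw [← mul_add, mul_nonneg_iff_of_pos_left hs]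
    constructor <;> intro h <;> linarith
  by_cases hz : z ∈ bridgeSet p
  · rw [Set.indicator_of_mem hz, Set.indicator_of_mem (this.2 hz)]
  · rw [Set.indicator_of_notMem hz, Set.indicator_of_notMem (fun h => hz (this.1 h))]

/-! ### Growth of the coefficients -/

/-- Comparison of an integral over a slice with the integral over a slab around it. -/
theorem slice_le_lintegral {p : ℕ} {H : (Fin (p + 1) → ℝ) → ℝ≥0∞} (hH : Measurable H) (s : ℝ)
    {F : (Fin p → ℝ) → ℝ≥0∞}
    (h : ∀ u, ∀ θ ∈ Set.Icc (0 : ℝ) 1, F u ≤ H (bridge u + θ • Pi.single 0 1 + s • 1)) :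
    ENNReal.ofReal (p + 1) * ∫⁻ u, F u ≤ ∫⁻ x, H x := by
  rw [← lintegral_add_right_eq_self H (s • 1),
    lintegral_slices_single (H := fun x => H (x + s • 1)) (hH.comp (measurable_add_const _))]
  gcongr
  calc ∫⁻ u, F u = ∫⁻ _ in Set.Icc (0 : ℝ) 1, ∫⁻ u, F u := by simp
    _ ≤ ∫⁻ θ in Set.Icc (0 : ℝ) 1,
          ∫⁻ u : Fin p → ℝ, H (bridge u + θ • Pi.single 0 1 + s • 1) :=
        setLIntegral_mono' measurableSet_Icc fun θ hθ => lintegral_mono fun u => h u θ hθ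
    _ ≤ _ := setLIntegral_le_lintegral _ _

theorem measurableSet_simplex (n : ℕ) (r : ℝ) :
    MeasurableSet {x : Fin n → ℝ | 0 ≤ x ∧ ∑ i, x i ≤ r} :=
  ((isClosed_le continuous_const continuous_id).inter
    (isClosed_le (f := fun x : Fin n → ℝ => ∑ i, x i) (by fun_prop)
      continuous_const)).measurableSet

theorem volume_simplex_le (n : ℕ) {r : ℝ} (hr : 0 ≤ r) :
    volume {x : Fin n → ℝ | 0 ≤ x ∧ ∑ i, x i ≤ r} ≤ ENNReal.ofReal (r ^ n / n !) := by
  induction n generalizing r with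
  | zero =>
    refine (measure_mono (Set.subset_univ _)).trans ?_
    rw [Measure.volume_pi_eq_dirac]
    simp
  | succ n ih =>
    rw [← lintegral_indicator_one (measurableSet_simplex _ _),
      lintegral_snoc (measurable_one.indicator (measurableSet_simplex _ _))]
    have key : ∀ τ : ℝ, ∫⁻ u : Fin n → ℝ, {x : Fin (n + 1) → ℝ | 0 ≤ x ∧ ∑ i, x i ≤ r}.indicator 1
        (Fin.snoc u τ) ≤
        (Set.Icc 0 r).indicator (fun τ => ENNReal.ofReal ((r - τ) ^ n / n !)) τ := by
      intro τ
      have hmem : ∀ u : Fin n → ℝ, (Fin.snoc u τ : Fin (n + 1) → ℝ) ∈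
          {x : Fin (n + 1) → ℝ | 0 ≤ x ∧ ∑ i, x i ≤ r} ↔
          0 ≤ τ ∧ u ∈ {x : Fin n → ℝ | 0 ≤ x ∧ ∑ i, x i ≤ r - τ} := by
        intro u
        simp only [Set.mem_ofPred_eq, Fin.sum_univ_castSucc, Fin.snoc_castSucc, Fin.snoc_last,
          Pi.le_def, Pi.zero_apply, Fin.forall_fin_succ']
        constructor
        · rintro ⟨⟨h1, h2⟩, h3⟩; exact ⟨h2, h1, by linarith⟩
        · rintro ⟨h2, h1, h3⟩; exact ⟨⟨h1, h2⟩, by linarith⟩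
      by_cases hτ : τ ∈ Set.Icc 0 r
      · rw [Set.indicator_of_mem hτ]
        refine le_trans (le_of_eq ?_) (ih (sub_nonneg.2 hτ.2))
        rw [← lintegral_indicator_one (measurableSet_simplex _ _)]
        refine lintegral_congr fun u => ?_
        by_cases hu : u ∈ {x : Fin n → ℝ | 0 ≤ x ∧ ∑ i, x i ≤ r - τ}
        · rw [Set.indicator_of_mem hu, Set.indicator_of_mem ((hmem u).2 ⟨hτ.1, hu⟩)]; rfl
        · rw [Set.indicator_of_notMem hu, Set.indicator_of_notMem fun h => hu ((hmem u).1 h).2]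
      · rw [Set.indicator_of_notMem hτ]
        refine le_of_eq ?_
        rw [lintegral_eq_zero_iff']
        · refine ae_of_all _ fun u => Set.indicator_of_notMem (fun h => hτ ?_) _
          obtain ⟨h1, h2, h3⟩ := (hmem u).1 h
          have : 0 ≤ ∑ i, u i := Finset.sum_nonneg fun i _ => h2 i
          exact ⟨h1, by linarith⟩
        · refine ((measurable_one.indicator (measurableSet_simplex _ _)).comp ?_).aemeasurable
          refine measurable_pi_lambda _ fun i => ?_
          refine Fin.lastCases ?_ (fun i => ?_) i
          · simp
          · simpa using measurable_pi_apply i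
    refine (lintegral_mono key).trans ?_
    rw [lintegral_indicator measurableSet_Icc, ← ofReal_integral_eq_lintegral_ofReal]
    · refine ENNReal.ofReal_le_ofReal (le_of_eq ?_)
      rw [integral_Icc_eq_integral_Ioc, ← intervalIntegral.integral_of_le hr,
        intervalIntegral.integral_comp_sub_left (fun x => x ^ n / (n ! : ℝ)) r,
        intervalIntegral.integral_div, integral_pow, Nat.factorial_succ]
      push_cast
      simp
      field_simp
    · exact (Continuous.continuousOn (by fun_prop)).integrableOn_Icc
    · refine (ae_restrict_iff' measurableSet_Icc).2 (ae_of_all _ fun τ hτ => ?_)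
      have : 0 ≤ r - τ := sub_nonneg.2 hτ.2
      positivity

/-- Adding $1$ to every increment and $\theta\in[0,1]$ to the first one turns the slice into a slab
inside a simplex: the increments become nonnegative, with sum $p+1+\theta$ minus the last entry,
hence at most $p+2$. -/
theorem volume_bridgeSet_le (p : ℕ) :
    ENNReal.ofReal (p + 1) * volume (bridgeSet p) ≤
      ENNReal.ofReal ((p + 2 : ℝ) ^ (p + 1) / (p + 1)!) := by
  have hr : (0 : ℝ) ≤ p + 2 := by positivity
  refine le_trans ?_ (volume_simplex_le (p + 1) hr)
  rw [← lintegral_indicator_one (measurableSet_simplex _ _),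
    ← lintegral_indicator_one (measurableSet_bridgeSet p)]
  refine slice_le_lintegral (measurable_one.indicator (measurableSet_simplex _ _)) 1
    fun u θ hθ => ?_
  by_cases hu : u ∈ bridgeSet p
  · rw [Set.indicator_of_mem hu, Set.indicator_of_mem]
    · exact le_rfl
    · refine ⟨fun i => ?_, ?_⟩
      · have h1 := hu.2 i
        have h2 : 0 ≤ θ * (Pi.single 0 1 : Fin (p + 1) → ℝ) i :=
          mul_nonneg hθ.1 (by rw [Pi.single_apply]; split_ifs <;> norm_num)
        simp only [Pi.add_apply, Pi.smul_apply, smul_eq_mul, Pi.one_apply, Pi.neg_apply,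
          Pi.zero_apply] at h1 ⊢
        linarith
      · have h1 := lastEntry_nonneg hu.1
        simp only [Pi.add_apply, Finset.sum_add_distrib, sum_bridge, Pi.smul_apply, smul_eq_mul,
          ← Finset.mul_sum, Finset.sum_pi_single']
        simp
        linarith [hθ.2]
  · rw [Set.indicator_of_notMem hu]; exact zero_le

theorem volume_bridgeSet_lt_top (p : ℕ) : volume (bridgeSet p) < ∞ := by
  have h := lt_of_le_of_lt (volume_bridgeSet_le p) ENNReal.ofReal_lt_top
  by_contra hcon
  rw [not_lt, top_le_iff] at hcon
  rw [hcon, ENNReal.mul_top (by simp; positivity)] at h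
  exact lt_irrefl _ h

theorem c_pos (p : ℕ) : 0 < c (p + 1) := by
  rw [c_succ]
  exact mul_pos (l_pos p)
    (ENNReal.toReal_pos (volume_bridgeSet_pos p).ne' (volume_bridgeSet_lt_top p).ne)

theorem c_le (p : ℕ) : c (p + 1) ≤ (p + 2 : ℝ) ^ (p + 2) / (2 * (p + 1)!) := by
  have h := ENNReal.toReal_mono ENNReal.ofReal_ne_top (volume_bridgeSet_le p)
  rw [ENNReal.toReal_mul, ENNReal.toReal_ofReal (by positivity),
    ENNReal.toReal_ofReal (by positivity)] at h
  rw [c_succ, l]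
  calc ((p + 1 : ℕ) : ℝ) * ((p + 1 : ℕ) + 1) / 2 * volume.real (bridgeSet p)
      = ((p : ℝ) + 2) / 2 * ((p + 1) * (volume (bridgeSet p)).toReal) := by
        push_cast; rw [Measure.real]; ring
    _ ≤ ((p : ℝ) + 2) / 2 * ((p + 2 : ℝ) ^ (p + 1) / (p + 1)!) := by gcongr
    _ = _ := by rw [pow_succ (_ : ℝ) (p + 1)]; field_simp

/-- Stirling's lower bound, with the factor $\sqrt{2\pi}$ dropped, against $(n+1)^{n+1}\le
e\,n^n\cdot 2n$. -/
theorem c_le_sqrt_mul_exp (p : ℕ) :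
    c (p + 1) ≤ Real.exp 1 * (Real.sqrt (p + 1 : ℕ) * Real.exp (p + 1 : ℕ)) := by
  set n : ℕ := p + 1 with hn
  have hn0 : (0 : ℝ) < n := by rw [hn]; positivity
  have hc : c n ≤ (n + 1 : ℝ) ^ (n + 1) / (2 * n !) := by
    have := c_le p
    rw [← hn] at this
    convert this using 2
    rw [hn]; push_cast; ring
  have hst := Stirling.le_factorial_stirling n
  have h2 : Real.sqrt n * (n / Real.exp 1) ^ n ≤ n ! := by
    refine le_trans ?_ hst
    gcongr
    nlinarith [Real.pi_gt_three]
  have h3 : ((n : ℝ) + 1) ^ n ≤ Real.exp 1 * n ^ n := by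
    have h4 : (1 + 1 / (n : ℝ)) ^ n ≤ Real.exp 1 := by
      have h5 : 1 + 1 / (n : ℝ) ≤ Real.exp (1 / n) := by linarith [Real.add_one_le_exp (1 / (n : ℝ))]
      calc (1 + 1 / (n : ℝ)) ^ n ≤ Real.exp (1 / n) ^ n := by gcongr
        _ = Real.exp 1 := by rw [← Real.exp_nat_mul]; congr 1; field_simp
    calc ((n : ℝ) + 1) ^ n = (1 + 1 / (n : ℝ)) ^ n * n ^ n := by
          rw [← mul_pow]; congr 1; field_simp
      _ ≤ _ := by gcongr
  refine hc.trans ?_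
  rw [div_le_iff₀ (by positivity)]
  have hexp : Real.exp (n : ℝ) = Real.exp 1 ^ n := by rw [← Real.exp_nat_mul, mul_one]
  have hn1 : (1 : ℝ) ≤ n := by rw [hn]; push_cast; linarith [Nat.cast_nonneg (α := ℝ) p]
  calc ((n : ℝ) + 1) ^ (n + 1) = (n + 1) ^ n * (n + 1) := pow_succ _ _
    _ ≤ (Real.exp 1 * n ^ n) * (2 * n) := by gcongr; linarith
    _ = Real.exp 1 * (Real.sqrt n * Real.exp n) * (2 * (Real.sqrt n * (n / Real.exp 1) ^ n)) := by
        rw [hexp, div_pow]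
        have : Real.sqrt n * Real.sqrt n = n := Real.mul_self_sqrt hn0.le
        have he : Real.exp 1 ^ n ≠ 0 := by positivity
        field_simp
        rw [Real.sq_sqrt hn0.le]
    _ ≤ _ := by gcongr

theorem c_isBigO : c =O[atTop] fun k : ℕ => Real.sqrt k * Real.exp k := by
  refine IsBigO.of_bound (Real.exp 1) ?_
  filter_upwards [eventually_ge_atTop 1] with k hk
  obtain ⟨p, rfl⟩ : ∃ p, k = p + 1 := ⟨k - 1, by omega⟩
  rw [Real.norm_of_nonneg (c_pos p).le, Real.norm_of_nonneg (by positivity)]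
  exact c_le_sqrt_mul_exp p

/-- Off $t=1$ the argument of the series stays strictly inside the radius $e^{-1}$ guaranteed by the
growth bound on `c`. -/
theorem mul_exp_neg_lt {t : ℝ} (ht : t ≠ 1) : t * Real.exp (-t) < Real.exp (-1) := by
  have h := Real.add_one_lt_exp (sub_ne_zero.2 ht)
  calc t * Real.exp (-t) = (t - 1 + 1) * Real.exp (-t) := by ring
    _ < Real.exp (t - 1) * Real.exp (-t) := by gcongr
    _ = Real.exp (-1) := by rw [← Real.exp_add]; congr 1; ring

theorem summable_c_mul_pow {q : ℝ} (hq0 : 0 ≤ q) (hq : q < Real.exp (-1)) :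
    Summable fun k : ℕ => c (k + 1) * q ^ k := by
  have hr : ‖q * Real.exp 1‖ < 1 := by
    rw [Real.norm_of_nonneg (by positivity)]
    calc q * Real.exp 1 < Real.exp (-1) * Real.exp 1 := by gcongr
      _ = 1 := by rw [← Real.exp_add]; simp
  have hs := summable_pow_mul_geometric_of_norm_lt_one 1 hr
  have hs0 := summable_geometric_of_norm_lt_one hr
  refine Summable.of_nonneg_of_le (fun k => mul_nonneg (c_pos k).le (by positivity)) (fun k => ?_)
    ((hs.add hs0).mul_left (Real.exp 1 * Real.exp 1))
  have h1 : Real.sqrt (k + 1 : ℕ) ≤ k + 1 := by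
    rw [Real.sqrt_le_left (by positivity)]
    push_cast
    nlinarith [Nat.cast_nonneg (α := ℝ) k]
  calc c (k + 1) * q ^ k ≤ Real.exp 1 * ((k + 1) * Real.exp (k + 1 : ℕ)) * q ^ k := by
        gcongr
        exact (c_le_sqrt_mul_exp k).trans (by gcongr)
    _ = _ := by
        push_cast
        rw [Real.exp_add, mul_pow, ← Real.exp_nat_mul, mul_one, pow_one]
        ring

theorem summable_c_mul_exp {t : ℝ} (ht : t ∈ Set.Ico (0 : ℝ) 1) :
    Summable fun k : ℕ => c (k + 1) * (t * Real.exp (-t)) ^ k :=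
  summable_c_mul_pow (mul_nonneg ht.1 (Real.exp_pos _).le) (mul_exp_neg_lt ht.2.ne)

/-! ### The Markov property of the area process -/

/-- The double partial sum `S_1 + ... + S_k = l_k Y_k`. -/
def areaSum {Ω : Type*} (X : ℕ → Ω → ℝ) (k : ℕ) (ω : Ω) : ℝ := ∑ i ∈ Finset.Icc 1 k, S X i ω

/-- The vector of the first `k` increments. -/
def past {Ω : Type*} (X : ℕ → Ω → ℝ) (k : ℕ) (ω : Ω) : Fin k → ℝ := fun i => X i ω

/-- The probability that the walk with increments `X_i - s`, started with the area `b` and at the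
position `d`, has nonnegative area for the next `m` steps. -/
def survival : ℕ → ℝ → ℝ → ℝ → ℝ≥0∞
  | 0, _, _, _ => 1
  | m + 1, s, b, d => ∫⁻ x, (if 0 ≤ b + d + x - s then survival m s (b + d + x - s) (d + x - s)
      else 0) ∂expMeasure 1

instance isProbabilityMeasure_expMeasure_one : IsProbabilityMeasure (expMeasure 1) :=
  isProbabilityMeasure_expMeasure one_pos

theorem measurable_survival (m : ℕ) :
    Measurable fun q : ℝ × ℝ × ℝ => survival m q.1 q.2.1 q.2.2 := by
  induction m with
  | zero => exact measurable_const
  | succ m ih =>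
    have h : Measurable fun r : (ℝ × ℝ × ℝ) × ℝ =>
        if 0 ≤ r.1.2.1 + r.1.2.2 + r.2 - r.1.1 then
          survival m r.1.1 (r.1.2.1 + r.1.2.2 + r.2 - r.1.1) (r.1.2.2 + r.2 - r.1.1) else 0 := by
      refine Measurable.ite (measurableSet_le measurable_const (by fun_prop)) ?_ measurable_const
      exact ih.comp (f := fun r : (ℝ × ℝ × ℝ) × ℝ =>
        (r.1.1, r.1.2.1 + r.1.2.2 + r.2 - r.1.1, r.1.2.2 + r.2 - r.1.1)) (by fun_prop)
    exact h.lintegral_prod_right'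

theorem expMeasure_one_eq : expMeasure 1 = volume.withDensity (exponentialPDF 1) := rfl

theorem measurable_exponentialPDF (r : ℝ) : Measurable (exponentialPDF r) :=
  (measurable_exponentialPDFReal r).ennreal_ofReal

/-- Lack of memory. Shifting the next increment by $a$ reproduces the walk started at position $0$,
and the exponential density pays $e^{-a}$. With no step left there would be nothing to pay, hence
the index `m + 1`. -/
theorem survival_neg (m : ℕ) {s a : ℝ} (hs : 0 ≤ s) (ha : 0 ≤ a) :
    survival (m + 1) s 0 (-a) = ENNReal.ofReal (Real.exp (-a)) * survival (m + 1) s 0 0 := by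
  have hm : ∀ d : ℝ, Measurable fun x : ℝ =>
      if 0 ≤ 0 + d + x - s then survival m s (0 + d + x - s) (d + x - s) else 0 := fun d => by
    refine Measurable.ite (measurableSet_le measurable_const (by fun_prop)) ?_ measurable_const
    exact (measurable_survival m).comp (f := fun x : ℝ => (s, 0 + d + x - s, d + x - s))
      (by fun_prop)
  rw [survival, survival, expMeasure_one_eq,
    lintegral_withDensity_eq_lintegral_mul _ (measurable_exponentialPDF 1) (hm _),
    lintegral_withDensity_eq_lintegral_mul _ (measurable_exponentialPDF 1) (hm _),
    ← lintegral_add_right_eq_self _ a, ← lintegral_const_mul _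
      ((measurable_exponentialPDF 1).mul (hm _))]
  refine lintegral_congr fun x => ?_
  simp only [Pi.mul_apply]
  rw [show (0 : ℝ) + -a + (x + a) - s = x - s by ring, show (0 : ℝ) + 0 + x - s = x - s by ring,
    show -a + (x + a) - s = x - s by ring, show (0 : ℝ) + x - s = x - s by ring]
  split_ifs with h
  -- Surviving the step means $x\ge s\ge0$, so both $x$ and $x+a$ lie in the support of the density.
  · rw [exponentialPDF_of_nonneg (by linarith), exponentialPDF_of_nonneg (by linarith), ← mul_assoc,
      ← ENNReal.ofReal_mul (Real.exp_pos _).le]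
    congr 2
    simp only [one_mul]
    rw [← Real.exp_add]; congr 1; ring
  · simp

theorem areaSum_succ {Ω : Type*} (X : ℕ → Ω → ℝ) (k : ℕ) (ω : Ω) :
    areaSum X (k + 1) ω = areaSum X k ω + S X k ω + X k ω := by
  rw [areaSum, Finset.sum_Icc_succ_top (by omega), S, Finset.sum_range_succ, areaSum, S]
  ring

theorem S_succ {Ω : Type*} (X : ℕ → Ω → ℝ) (k : ℕ) (ω : Ω) :
    S X (k + 1) ω = S X k ω + X k ω := by
  rw [S, Finset.sum_range_succ, S]

theorem l_succ (k : ℕ) : l (k + 1) = l k + k + 1 := by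
  simp only [l]; push_cast; ring

theorem l_zero : l 0 = 0 := by simp [l]

theorem sum_past {Ω : Type*} (X : ℕ → Ω → ℝ) (k : ℕ) (ω : Ω) :
    ∑ i, past X k ω i = S X k ω := by
  rw [S, ← Fin.sum_univ_eq_sum_range (fun i => X i ω)]; rfl

theorem area_past {Ω : Type*} (X : ℕ → Ω → ℝ) {j k : ℕ} (h : j ≤ k) (ω : Ω) :
    area (past X k ω) j = areaSum X j ω := by
  have hr : area (past X k ω) j = ∑ i ∈ Finset.range k, ((j - i : ℕ) : ℝ) * X i ω := by
    rw [← Fin.sum_univ_eq_sum_range (fun i => ((j - i : ℕ) : ℝ) * X i ω)]; rfl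
  have hr2 : ∑ i ∈ Finset.range k, ((j - i : ℕ) : ℝ) * X i ω =
      ∑ i ∈ Finset.range j, ((j - i : ℕ) : ℝ) * X i ω := by
    symm
    refine Finset.sum_subset (Finset.range_subset_range.2 h) fun i _ hi => ?_
    rw [Nat.sub_eq_zero_of_le (by simpa using hi)]; simp
  rw [hr, hr2]
  clear hr hr2 h
  induction j with
  | zero => simp [areaSum]
  | succ j ih =>
    rw [areaSum_succ, ← ih, Finset.sum_range_succ, S, ← Finset.sum_add_distrib]
    congr 1
    · refine Finset.sum_congr rfl fun i hi => ?_
      rw [Finset.mem_range] at hi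
      rw [Nat.succ_sub hi.le]; push_cast; ring
    · simp

theorem Y_eq_div {Ω : Type*} (X : ℕ → Ω → ℝ) (k : ℕ) (ω : Ω) :
    Y X k ω = areaSum X k ω / l k := by
  rw [Y, areaSum, l, div_div_eq_mul_div, div_mul_eq_mul_div, mul_comm]

theorem le_Y_iff {Ω : Type*} (X : ℕ → Ω → ℝ) {k : ℕ} (hk : 1 ≤ k) (ω : Ω) (t : ℝ) :
    t ≤ Y X k ω ↔ t * l k ≤ areaSum X k ω := by
  obtain ⟨k, rfl⟩ : ∃ j, k = j + 1 := ⟨k - 1, by omega⟩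
  rw [Y_eq_div, le_div_iff₀ (l_pos k)]

theorem Gn_set {Ω : Type*} (X : ℕ → Ω → ℝ) (n : ℕ) (t : ℝ) :
    {ω | (t : EReal) ≤ ⨅ k ∈ Finset.Icc 1 n, (Y X k ω : EReal)} =
      {ω | ∀ k ∈ Finset.Icc 1 n, t ≤ Y X k ω} := by
  ext ω; simp only [Set.mem_ofPred_eq, le_iInf_iff, EReal.coe_le_coe_iff]

theorem G_set {Ω : Type*} (X : ℕ → Ω → ℝ) (t : ℝ) :
    {ω | (t : EReal) ≤ ⨅ k ∈ Set.Ici 1, (Y X k ω : EReal)} =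
      {ω | ∀ k, 1 ≤ k → t ≤ Y X k ω} := by
  ext ω; simp only [Set.mem_ofPred_eq, le_iInf_iff, EReal.coe_le_coe_iff, Set.mem_Ici]

section

variable {Ω : Type*} [MeasurableSpace Ω] {P : Measure Ω} {X : ℕ → Ω → ℝ}

theorem measurable_past (hX : ∀ i, Measurable (X i)) (k : ℕ) : Measurable (past X k) :=
  measurable_pi_lambda _ fun i => hX i

theorem measurable_S (hX : ∀ i, Measurable (X i)) (k : ℕ) : Measurable (S X k) :=
  Finset.measurable_sum _ fun i _ => hX i

theorem measurable_areaSum (hX : ∀ i, Measurable (X i)) (k : ℕ) : Measurable (areaSum X k) :=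
  Finset.measurable_sum _ fun i _ => measurable_S hX i

theorem measurable_Y (hX : ∀ i, Measurable (X i)) (k : ℕ) : Measurable (Y X k) :=
  (measurable_areaSum hX k).const_mul _

theorem indepFun_past [IsProbabilityMeasure P] (hX : ∀ i, Measurable (X i))
    (hindep : iIndepFun X P) (k : ℕ) : IndepFun (past X k) (X k) P := by
  have h := hindep.indepFun_finset (Finset.range k) {k} (by simp) hX
  have h1 : Measurable fun (z : Finset.range k → ℝ) (i : Fin k) => z ⟨i, by simp⟩ := by fun_prop
  have h2 : Measurable fun z : ({k} : Finset ℕ) → ℝ => z ⟨k, by simp⟩ := by fun_prop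
  exact h.comp h1 h2

theorem lintegral_past_next [IsProbabilityMeasure P] (hX : ∀ i, Measurable (X i))
    (hlaw : ∀ i, HasLaw (X i) (expMeasure 1) P) (hindep : iIndepFun X P) (k : ℕ)
    {g : (Fin k → ℝ) × ℝ → ℝ≥0∞} (hg : Measurable g) :
    ∫⁻ ω, g (past X k ω, X k ω) ∂P = ∫⁻ ω, ∫⁻ x, g (past X k ω, x) ∂expMeasure 1 ∂P := by
  have h := (indepFun_past hX hindep k).map_prod_eq_prod_map_map
    (measurable_past hX k).aemeasurable (hX k).aemeasurable
  rw [(hlaw k).map_eq] at h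
  rw [← lintegral_map hg ((measurable_past hX k).prodMk (hX k)), h,
    lintegral_prod _ hg.aemeasurable,
    lintegral_map (hg.lintegral_prod_right') (measurable_past hX k)]

/-- The Markov property at time `k`. The level `s` may depend on the past, because it will be taken
equal to $Y_k$. -/
theorem lintegral_survival [IsProbabilityMeasure P] (hX : ∀ i, Measurable (X i))
    (hlaw : ∀ i, HasLaw (X i) (expMeasure 1) P) (hindep : iIndepFun X P) (m k : ℕ)
    {F : (Fin k → ℝ) → ℝ≥0∞} (hF : Measurable F) {s : (Fin k → ℝ) → ℝ} (hs : Measurable s) :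
    ∫⁻ ω, F (past X k ω) *
      {ω | ∀ j ∈ Finset.Ioc k (k + m), s (past X k ω) * l j ≤ areaSum X j ω}.indicator 1 ω ∂P =
    ∫⁻ ω, F (past X k ω) * survival m (s (past X k ω))
      (areaSum X k ω - s (past X k ω) * l k) (S X k ω - s (past X k ω) * k) ∂P := by
  induction m generalizing k with
  | zero => simp [survival]
  | succ m ih =>
    have hinit : Measurable fun x : Fin (k + 1) → ℝ => (Fin.init x : Fin k → ℝ) :=
      measurable_pi_lambda _ fun i => measurable_pi_apply _
    have hpast : ∀ ω, (Fin.init (past X (k + 1) ω) : Fin k → ℝ) = past X k ω := fun ω => rfl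
    have harea : ∀ ω, area (past X (k + 1) ω) (k + 1) = areaSum X (k + 1) ω :=
      fun ω => area_past X le_rfl ω
    -- The constraint at time `k + 1` is moved from the future into the weight on the past, so that
    -- the induction hypothesis applies at `k + 1`.
    set F' : (Fin (k + 1) → ℝ) → ℝ≥0∞ := fun x =>
      F (Fin.init x) * {x | s (Fin.init x) * l (k + 1) ≤ area x (k + 1)}.indicator 1 x with hF'
    have hF'm : Measurable F' := by
      refine (hF.comp hinit).mul (measurable_one.indicator ?_)
      exact measurableSet_le ((hs.comp hinit).mul_const _) (continuous_area _).measurable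
    have hIH := ih (k + 1) hF'm (hs.comp hinit)
    have hL : ∀ ω, F (past X k ω) * {ω | ∀ j ∈ Finset.Ioc k (k + (m + 1)),
        s (past X k ω) * l j ≤ areaSum X j ω}.indicator 1 ω =
        F' (past X (k + 1) ω) * {ω | ∀ j ∈ Finset.Ioc (k + 1) (k + 1 + m),
          (s ∘ Fin.init) (past X (k + 1) ω) * l j ≤ areaSum X j ω}.indicator 1 ω := by
      intro ω
      rw [hF', mul_assoc]
      simp only [Set.indicator_apply, Set.mem_ofPred_eq, hpast, harea, Function.comp_apply,
        Pi.one_apply, ← ite_and, mul_ite, mul_one, mul_zero]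
      refine if_congr ?_ rfl rfl
      constructor
      · intro h
        exact ⟨fun j hj => h j (by simp only [Finset.mem_Ioc] at hj ⊢; omega),
          h (k + 1) (by simp only [Finset.mem_Ioc]; omega)⟩
      · rintro ⟨h2, h1⟩ j hj
        simp only [Finset.mem_Ioc] at hj
        rcases eq_or_ne j (k + 1) with rfl | hne
        · exact h1
        · exact h2 j (by simp only [Finset.mem_Ioc]; omega)
    rw [lintegral_congr hL, hIH]
    set g : (Fin k → ℝ) × ℝ → ℝ≥0∞ := fun q => F q.1 *
      (if 0 ≤ (area q.1 k - s q.1 * l k) + (∑ i, q.1 i - s q.1 * k) + q.2 - s q.1 then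
        survival m (s q.1) ((area q.1 k - s q.1 * l k) + (∑ i, q.1 i - s q.1 * k) + q.2 - s q.1)
          ((∑ i, q.1 i - s q.1 * k) + q.2 - s q.1) else 0) with hg
    have hareak : Measurable fun q : (Fin k → ℝ) × ℝ => area q.1 k :=
      (continuous_area k).measurable.comp measurable_fst
    have hsq : Measurable fun q : (Fin k → ℝ) × ℝ => s q.1 := hs.comp measurable_fst
    have hgm : Measurable g := by
      refine (hF.comp measurable_fst).mul (Measurable.ite
        (measurableSet_le measurable_const (by fun_prop)) ?_ measurable_const)
      exact (measurable_survival m).comp (hsq.prodMk (Measurable.prodMk (by fun_prop)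
        (by fun_prop)))
    -- Integrating out the single increment `X k` reproduces the recursion that defines `survival`.
    have hR := lintegral_past_next hX hlaw hindep k hgm
    have h1 : ∀ ω, F' (past X (k + 1) ω) * survival m ((s ∘ Fin.init) (past X (k + 1) ω))
        (areaSum X (k + 1) ω - (s ∘ Fin.init) (past X (k + 1) ω) * l (k + 1))
        (S X (k + 1) ω - (s ∘ Fin.init) (past X (k + 1) ω) * (k + 1 : ℕ)) =
        g (past X k ω, X k ω) := by
      intro ω
      rw [hF', hg, mul_assoc]
      simp only [Set.indicator_apply, Set.mem_ofPred_eq, hpast, harea, Function.comp_apply,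
        Pi.one_apply, ite_mul, one_mul, zero_mul, sum_past, area_past X le_rfl]
      have e1 : areaSum X k ω - s (past X k ω) * l k + (S X k ω - s (past X k ω) * k) + X k ω -
          s (past X k ω) = areaSum X (k + 1) ω - s (past X k ω) * l (k + 1) := by
        rw [areaSum_succ, l_succ]; ring
      have e2 : S X k ω - s (past X k ω) * k + X k ω - s (past X k ω) =
          S X (k + 1) ω - s (past X k ω) * (k + 1 : ℕ) := by
        rw [S_succ]; push_cast; ring
      rw [e1, e2]
      simp only [sub_nonneg]
    rw [lintegral_congr h1, hR]
    refine lintegral_congr fun ω => ?_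
    rw [hg]
    simp only [sum_past, area_past X le_rfl]
    rw [survival, lintegral_const_mul]
    refine Measurable.ite (measurableSet_le measurable_const (by fun_prop)) ?_ measurable_const
    exact (measurable_survival m).comp (measurable_const.prodMk (Measurable.prodMk (by fun_prop)
        (by fun_prop)))

theorem measurableSet_Gn (hX : ∀ i, Measurable (X i)) (n : ℕ) (t : ℝ) :
    MeasurableSet {ω | ∀ k ∈ Finset.Icc 1 n, t ≤ Y X k ω} := by
  simp only [Set.ofPred_forall]
  exact Finset.measurableSet_biInter _ fun k _ => measurableSet_le measurable_const
    (measurable_Y hX k)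

theorem survival_zero_zero [IsProbabilityMeasure P] (hX : ∀ i, Measurable (X i))
    (hlaw : ∀ i, HasLaw (X i) (expMeasure 1) P) (hindep : iIndepFun X P) (m : ℕ) (t : ℝ) :
    survival m t 0 0 = ENNReal.ofReal (Gn P X m t) := by
  have h := lintegral_survival hX hlaw hindep m 0 (F := fun _ => 1) measurable_const
    (s := fun _ => t) measurable_const
  have hset : {ω | ∀ j ∈ Finset.Ioc 0 (0 + m), t * l j ≤ areaSum X j ω} =
      {ω | ∀ k ∈ Finset.Icc 1 m, t ≤ Y X k ω} := by
    ext ω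
    simp only [Set.mem_ofPred_eq, Finset.mem_Ioc, Finset.mem_Icc, zero_add]
    exact forall_congr' fun j => ⟨fun h hj => (le_Y_iff X hj.1 ω t).2 (h hj),
      fun h hj => (le_Y_iff X hj.1 ω t).1 (h hj)⟩
  simp only [one_mul, hset] at h
  rw [lintegral_indicator_one (measurableSet_Gn hX m t)] at h
  simp only [areaSum, S, l_zero] at h
  simp only [Gn, Gn_set, Measure.real, ENNReal.ofReal_toReal (measure_ne_top _ _)]
  rw [h]; simp

/-! ### The law of the increments -/

theorem lintegral_pi_withDensity {f : ℝ → ℝ≥0∞} (hf : Measurable f)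
    [SigmaFinite ((volume : Measure ℝ).withDensity f)] (k : ℕ) {F : (Fin k → ℝ) → ℝ≥0∞}
    (hF : Measurable F) :
    ∫⁻ x, F x ∂Measure.pi (fun _ : Fin k => (volume : Measure ℝ).withDensity f) =
      ∫⁻ x, (∏ i, f (x i)) * F x := by
  induction k with
  | zero => rw [Measure.pi_of_empty, Measure.volume_pi_eq_dirac]; simp
  | succ k ih =>
    have h := (measurePreserving_piFinSuccAbove
      (fun _ : Fin (k + 1) => (volume : Measure ℝ).withDensity f) (Fin.last k)).symm
    have hprod : Measurable fun x : Fin (k + 1) → ℝ => (∏ i, f (x i)) * F x :=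
      (Finset.measurable_prod _ fun i _ => hf.comp (measurable_pi_apply i)).mul hF
    have hprod' : Measurable fun x : Fin k → ℝ => ∏ i, f (x i) :=
      Finset.measurable_prod _ fun i _ => hf.comp (measurable_pi_apply i)
    have hF2 := (hF.comp h.measurable).aemeasurable (μ := ((volume : Measure ℝ).withDensity f).prod
      (Measure.pi fun _ : Fin k => (volume : Measure ℝ).withDensity f))
    rw [← h.lintegral_comp hF, lintegral_snoc hprod]
    refine (lintegral_prod _ hF2).trans ?_
    have e : ∀ (τ : ℝ) (u : Fin k → ℝ),
        (MeasurableEquiv.piFinSuccAbove (fun _ => ℝ) (Fin.last k)).symm (τ, u) =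
          (Fin.snoc u τ : Fin (k + 1) → ℝ) := fun τ u => by
      simp [MeasurableEquiv.piFinSuccAbove, Fin.insertNthEquiv]
    have hFs : ∀ τ : ℝ, Measurable fun u : Fin k → ℝ => F (Fin.snoc u τ) := fun τ =>
      (hF.comp (measurable_snoc k)).comp measurable_prodMk_left
    simp only [Function.comp_apply, e]
    refine (lintegral_withDensity_eq_lintegral_mul _ hf
      (hF.comp (measurable_snoc k)).lintegral_prod_right').trans ?_
    refine lintegral_congr fun τ => ?_
    simp only [Pi.mul_apply, Function.comp_apply]
    rw [ih (hFs τ)]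
    refine (lintegral_const_mul _ (hprod'.mul (hFs τ))).symm.trans (lintegral_congr fun u => ?_)
    rw [Fin.prod_univ_castSucc]
    simp only [Fin.snoc_castSucc, Fin.snoc_last, Pi.mul_apply]
    ring

theorem prod_exponentialPDF {k : ℕ} (x : Fin k → ℝ) :
    ∏ i, exponentialPDF 1 (x i) =
      {x : Fin k → ℝ | 0 ≤ x}.indicator (fun x => ENNReal.ofReal (Real.exp (-∑ i, x i))) x := by
  by_cases hx : 0 ≤ x
  · rw [Set.indicator_of_mem (show x ∈ {x : Fin k → ℝ | 0 ≤ x} from hx), ← Finset.sum_neg_distrib,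
      Real.exp_sum, ENNReal.ofReal_prod_of_nonneg fun i _ => (Real.exp_pos _).le]
    exact Finset.prod_congr rfl fun i _ => by rw [exponentialPDF_of_nonneg (hx i)]; simp
  · rw [Set.indicator_of_notMem (show x ∉ {x : Fin k → ℝ | 0 ≤ x} from hx)]
    simp only [Pi.le_def, not_forall, not_le, Pi.zero_apply] at hx
    obtain ⟨i, hi⟩ := hx
    exact Finset.prod_eq_zero (Finset.mem_univ i) (exponentialPDF_of_neg hi)

theorem lintegral_past [IsProbabilityMeasure P] (hX : ∀ i, Measurable (X i))
    (hlaw : ∀ i, HasLaw (X i) (expMeasure 1) P) (hindep : iIndepFun X P) (k : ℕ)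
    {F : (Fin k → ℝ) → ℝ≥0∞} (hF : Measurable F) :
    ∫⁻ ω, F (past X k ω) ∂P = ∫⁻ x : Fin k → ℝ,
      {x : Fin k → ℝ | 0 ≤ x}.indicator (fun x => ENNReal.ofReal (Real.exp (-∑ i, x i))) x * F x := by
  have h := iIndepFun.map_fun_eq_pi_map (f := fun i : Fin k => X i)
    (fun i => (hX i).aemeasurable) (hindep.precomp (g := fun i : Fin k => (i : ℕ)) Fin.val_injective)
  have h2 : P.map (past X k) =
      Measure.pi fun _ : Fin k => (volume : Measure ℝ).withDensity (exponentialPDF 1) := by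
    refine Eq.trans h ?_
    congr 1
    funext i
    exact (hlaw i).map_eq
  have : SigmaFinite ((volume : Measure ℝ).withDensity (exponentialPDF 1)) := by
    rw [← expMeasure_one_eq]; infer_instance
  rw [← lintegral_map hF (measurable_past hX k), h2,
    lintegral_pi_withDensity (measurable_exponentialPDF 1) k hF]
  simp only [prod_exponentialPDF]

end

/-! ### Decomposition by the place of the minimum -/

/-- The event that `Y_k` is below `t` and is the first minimum of `Y_1, ..., Y_n`. -/
def firstMin {Ω : Type*} (X : ℕ → Ω → ℝ) (n k : ℕ) (t : ℝ) : Set Ω :=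
  {ω | Y X k ω < t ∧ (∀ j ∈ Finset.Ico 1 k, Y X k ω < Y X j ω) ∧
    ∀ j ∈ Finset.Ioc k n, Y X k ω ≤ Y X j ω}

/-- The contribution of the last step to `-G_{p+1}'`. -/
def lastDensity (p : ℕ) (s : ℝ) : ℝ :=
  l (p + 1) * s ^ p * Real.exp (-((p + 1) * s)) *
    ∫ z in bridgeSet p, Real.exp (s * lastEntry z)

theorem integrableOn_exp_lastEntry (p : ℕ) (s : ℝ) :
    IntegrableOn (fun z : Fin p → ℝ => Real.exp (s * lastEntry z)) (bridgeSet p) := by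
  refine Measure.integrableOn_of_bounded (M := Real.exp (|s| * (p + 1)))
    (volume_bridgeSet_lt_top p).ne ?_ ?_
  · exact (Real.continuous_exp.comp (continuous_const.mul
      (continuous_lastEntry p))).aestronglyMeasurable
  · refine (ae_restrict_iff' (measurableSet_bridgeSet p)).2 (ae_of_all _ fun z hz => ?_)
    rw [Real.norm_of_nonneg (Real.exp_pos _).le, Real.exp_le_exp]
    have h1 := lastEntry_nonneg hz.1
    exact mul_le_mul (le_abs_self s) (lastEntry_le hz) h1 (abs_nonneg s)

theorem continuous_lastDensity (p : ℕ) : Continuous (lastDensity p) := by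
  unfold lastDensity
  refine Continuous.mul (by fun_prop) ?_
  rw [continuous_iff_continuousAt]
  intro s₀
  refine continuousAt_of_dominated (bound := fun _ => Real.exp ((|s₀| + 1) * (p + 1))) ?_ ?_ ?_ ?_
  · exact Eventually.of_forall fun s => (integrableOn_exp_lastEntry p s).aestronglyMeasurable
  · filter_upwards [Metric.ball_mem_nhds s₀ one_pos] with s hs
    refine (ae_restrict_iff' (measurableSet_bridgeSet p)).2 (ae_of_all _ fun z hz => ?_)
    rw [Real.norm_of_nonneg (Real.exp_pos _).le, Real.exp_le_exp]
    have h1 := lastEntry_nonneg hz.1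
    refine mul_le_mul ?_ (lastEntry_le hz) h1 (by positivity)
    have h2 : |s - s₀| < 1 := by simpa [Real.dist_eq] using hs
    have h3 := abs_add_le (s - s₀) s₀
    rw [sub_add_cancel] at h3
    linarith [le_abs_self s]
  · have : IsFiniteMeasure (volume.restrict (bridgeSet p)) :=
      ⟨by simpa using volume_bridgeSet_lt_top p⟩
    exact integrable_const _
  · exact ae_of_all _ fun z => by fun_prop

theorem lastDensity_nonneg (p : ℕ) {s : ℝ} (hs : 0 ≤ s) : 0 ≤ lastDensity p s := by
  have := l_pos p
  have : 0 ≤ ∫ z in bridgeSet p, Real.exp (s * lastEntry z) :=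
    integral_nonneg fun z => (Real.exp_pos _).le
  unfold lastDensity
  positivity

/-- A first minimum asks for strict inequalities before it, whereas the polytope is closed; the
difference is a null set. -/
theorem ae_pos_iff_nonneg (p : ℕ) : ∀ᵐ u : Fin p → ℝ, (∀ j, 0 < u j) ↔ 0 ≤ u := by
  have h : ∀ᵐ u : Fin p → ℝ, ∀ j, u j ≠ 0 := by
    rw [ae_all_iff]
    exact fun j => Measure.ae_eval_ne (μ := fun _ : Fin p => (volume : Measure ℝ)) j 0
  filter_upwards [h] with u hu
  exact ⟨fun h j => (h j).le, fun h j => lt_of_le_of_ne (h j) (hu j).symm⟩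

theorem ofReal_lastDensity (p : ℕ) {s : ℝ} (hs : 0 ≤ s) :
    ENNReal.ofReal (lastDensity p s) = ENNReal.ofReal (l (p + 1) * s ^ p) *
      ∫⁻ z in bridgeSet p, ENNReal.ofReal (Real.exp (s * lastEntry z - (p + 1) * s)) := by
  rw [lastDensity, mul_assoc (l (p + 1) * s ^ p),
    ENNReal.ofReal_mul (mul_nonneg (l_pos p).le (pow_nonneg hs p)),
    ← integral_const_mul, ofReal_integral_eq_lintegral_ofReal]
  · congr 1
    refine lintegral_congr fun z => ?_
    rw [← Real.exp_add]
    congr 2; ring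
  · exact (integrableOn_exp_lastEntry p s).const_mul _
  · exact ae_of_all _ fun z => by positivity

section

variable {Ω : Type*} [MeasurableSpace Ω] {P : Measure Ω} {X : ℕ → Ω → ℝ}

theorem measurableSet_firstMin (hX : ∀ i, Measurable (X i)) (n k : ℕ) (t : ℝ) :
    MeasurableSet (firstMin X n k t) := by
  have h1 := measurableSet_lt (measurable_Y hX k) (measurable_const (a := t))
  have h2 : MeasurableSet {ω | ∀ j ∈ Finset.Ico 1 k, Y X k ω < Y X j ω} := by
    simp only [Set.ofPred_forall]
    exact Finset.measurableSet_biInter _ fun j _ =>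
      measurableSet_lt (measurable_Y hX k) (measurable_Y hX j)
  have h3 : MeasurableSet {ω | ∀ j ∈ Finset.Ioc k n, Y X k ω ≤ Y X j ω} := by
    simp only [Set.ofPred_forall]
    exact Finset.measurableSet_biInter _ fun j _ =>
      measurableSet_le (measurable_Y hX k) (measurable_Y hX j)
  exact h1.inter (h2.inter h3)

/-- Markov property at time `p + 1` with level $Y_{p+1}$, followed by slicing along that level $s$
and rescaling $u=sz$. -/
theorem measure_firstMin [IsProbabilityMeasure P] (hX : ∀ i, Measurable (X i))
    (hlaw : ∀ i, HasLaw (X i) (expMeasure 1) P) (hindep : iIndepFun X P) (p m : ℕ) (t : ℝ) :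
    P (firstMin X (p + 1 + m) (p + 1) t) = ∫⁻ s in Set.Ioo 0 t,
      ENNReal.ofReal (l (p + 1) * s ^ p) * ∫⁻ z in bridgeSet p,
        ENNReal.ofReal (Real.exp (s * lastEntry z - (p + 1) * s)) *
          survival m s 0 (-(s * lastEntry z)) := by
  set slope : (Fin (p + 1) → ℝ) → ℝ := fun x => area x (p + 1) / l (p + 1) with hslope
  have hslopem : Measurable slope := (continuous_area _).measurable.div_const _
  set Q : Set (Fin (p + 1) → ℝ) :=
    {x | slope x < t ∧ ∀ j : Fin p, slope x * l (j + 1) < area x (j + 1)} with hQ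
  have hQm : MeasurableSet Q := by
    refine (measurableSet_lt hslopem measurable_const).inter ?_
    change MeasurableSet {x | ∀ j : Fin p, slope x * l (j + 1) < area x (j + 1)}
    rw [Set.ofPred_forall]
    exact MeasurableSet.iInter fun j =>
      measurableSet_lt (hslopem.mul_const _) (continuous_area _).measurable
  have hY : ∀ ω, slope (past X (p + 1) ω) = Y X (p + 1) ω := fun ω => by
    rw [hslope, Y_eq_div]; simp only [area_past X le_rfl]
  have h := lintegral_survival hX hlaw hindep m (p + 1) (F := Q.indicator 1)
    (measurable_one.indicator hQm) hslopem
  have hleft : ∀ ω, Q.indicator (1 : (Fin (p + 1) → ℝ) → ℝ≥0∞) (past X (p + 1) ω) *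
      {ω | ∀ j ∈ Finset.Ioc (p + 1) (p + 1 + m),
        slope (past X (p + 1) ω) * l j ≤ areaSum X j ω}.indicator 1 ω =
      (firstMin X (p + 1 + m) (p + 1) t).indicator 1 ω := by
    intro ω
    classical
    simp only [Set.indicator_apply, Pi.one_apply, mul_ite, mul_one, mul_zero, ← ite_and]
    refine if_congr ?_ rfl rfl
    simp only [hQ, Set.mem_ofPred_eq, hY, firstMin]
    constructor
    · rintro ⟨h3, h1, h2⟩
      refine ⟨h1, fun j hj => ?_, fun j hj => ?_⟩
      · rw [Finset.mem_Ico] at hj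
        obtain ⟨i, rfl⟩ : ∃ i, j = i + 1 := ⟨j - 1, by omega⟩
        have := h2 ⟨i, by omega⟩
        rw [area_past X (by simp only; omega)] at this
        rwa [Y_eq_div X (i + 1), lt_div_iff₀ (l_pos _)]
      · rw [Finset.mem_Ioc] at hj
        exact (le_Y_iff X (by omega) ω _).2 (h3 j (by rw [Finset.mem_Ioc]; omega))
    · rintro ⟨h1, h2, h3⟩
      refine ⟨fun j hj => ?_, h1, fun j => ?_⟩
      · exact (le_Y_iff X (by rw [Finset.mem_Ioc] at hj; omega) ω _).1 (h3 j hj)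
      · have := h2 (j + 1) (by rw [Finset.mem_Ico]; omega)
        rw [area_past X (by omega)]
        rwa [Y_eq_div X (j + 1), lt_div_iff₀ (l_pos _)] at this
  rw [lintegral_congr hleft, lintegral_indicator_one (measurableSet_firstMin hX _ _ _)] at h
  -- At time `p + 1` the area relative to its own slope vanishes, so the future sees only the
  -- relative position.
  set K : (Fin (p + 1) → ℝ) → ℝ≥0∞ := fun x => Q.indicator 1 x *
    survival m (slope x) 0 (∑ i, x i - slope x * (p + 1)) with hK
  have hKm : Measurable K := by
    refine (measurable_one.indicator hQm).mul ((measurable_survival m).comp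
      (hslopem.prodMk (measurable_const.prodMk ?_)))
    fun_prop
  have hright : ∀ ω, Q.indicator (1 : (Fin (p + 1) → ℝ) → ℝ≥0∞) (past X (p + 1) ω) *
      survival m (slope (past X (p + 1) ω))
        (areaSum X (p + 1) ω - slope (past X (p + 1) ω) * l (p + 1))
        (S X (p + 1) ω - slope (past X (p + 1) ω) * (p + 1 : ℕ)) = K (past X (p + 1) ω) := by
    intro ω
    rw [hK]
    simp only [hslope, area_past X le_rfl, sum_past]
    rw [div_mul_cancel₀ _ (l_pos p).ne', sub_self]
    push_cast; rfl
  rw [lintegral_congr hright, lintegral_past hX hlaw hindep (p + 1) hKm] at h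
  have hpos : MeasurableSet {x : Fin (p + 1) → ℝ | 0 ≤ x} :=
    (isClosed_le continuous_const continuous_id).measurableSet
  have hexpm : Measurable fun x : Fin (p + 1) → ℝ => ENNReal.ofReal (Real.exp (-∑ i, x i)) := by
    fun_prop
  rw [h]
  refine (lintegral_slices_l ((hexpm.indicator hpos).mul hKm)).trans ?_
  rw [← lintegral_const_mul' _ _ ENNReal.ofReal_ne_top, ← lintegral_indicator measurableSet_Ioo]
  -- Nonnegative increments force only $s\ge0$; the endpoint is discarded as a null set.
  have hne : ∀ᵐ s : ℝ, s ≠ 0 := by simp [ae_iff]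
  refine lintegral_congr_ae ?_
  filter_upwards [hne] with s hs0
  have hsl : ∀ u : Fin p → ℝ, slope (bridge u + s • 1) = s := fun u => by
    rw [hslope]
    simp only [area_add, area_bridge_last, area_smul, area_const_one le_rfl, zero_add]
    rw [mul_div_cancel_right₀ _ (l_pos p).ne']
  have hQs : ∀ u : Fin p → ℝ, bridge u + s • 1 ∈ Q ↔ s < t ∧ ∀ j, 0 < u j := fun u => by
    rw [hQ]
    simp only [Set.mem_ofPred_eq, hsl]
    refine and_congr Iff.rfl (forall_congr' fun j => ?_)
    rw [area_add, area_bridge, area_smul, area_const_one (by omega)]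
    constructor <;> intro h <;> linarith
  have hsum : ∀ u : Fin p → ℝ, ∑ i, (bridge u + s • 1) i = -lastEntry u + s * (p + 1) := fun u => by
    simp only [Pi.add_apply, Finset.sum_add_distrib, sum_bridge]
    simp [mul_comm]
  by_cases hs : s ∈ Set.Ioo 0 t
  · rw [Set.indicator_of_mem hs, ENNReal.ofReal_mul (l_pos p).le, mul_assoc]
    congr 1
    have hfm : Measurable fun u : Fin p → ℝ =>
        ENNReal.ofReal (Real.exp (lastEntry u - (p + 1) * s)) * survival m s 0 (-lastEntry u) := by
      have := (continuous_lastEntry p).measurable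
      refine Measurable.mul (by fun_prop) ?_
      exact (measurable_survival m).comp (measurable_const.prodMk (measurable_const.prodMk this.neg))
    have := lintegral_smul_bridgeSet hs.1 hfm
    simp only [lastEntry_smul] at this
    rw [← this]
    refine lintegral_congr_ae ?_
    filter_upwards [ae_pos_iff_nonneg p] with u hu
    by_cases h2 : 0 ≤ bridge u + s • 1
    · by_cases h1 : 0 ≤ u
      · rw [Set.indicator_of_mem (show u ∈ {u : Fin p → ℝ | 0 ≤ u ∧ 0 ≤ bridge u + s • 1} from
          ⟨h1, h2⟩), Pi.mul_apply, Set.indicator_of_mem (show bridge u + s • 1 ∈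
          {x : Fin (p + 1) → ℝ | 0 ≤ x} from h2), hK]
        simp only [Set.indicator_of_mem ((hQs u).2 ⟨hs.2, hu.2 h1⟩), hsl, hsum, Pi.one_apply,
          one_mul]
        congr 2
        · congr 1; ring
        · ring
      · rw [Set.indicator_of_notMem fun h => h1 h.1, Pi.mul_apply, hK]
        simp only [Set.indicator_of_notMem fun h => h1 (hu.1 ((hQs u).1 h).2), zero_mul, mul_zero]
    · rw [Set.indicator_of_notMem fun h => h2 h.2, Pi.mul_apply, Set.indicator_of_notMem h2,
        zero_mul]
  -- Outside $(0,t)$ the slice contributes nothing: $s<0$ contradicts nonnegative increments, $s\ge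
  -- t$ contradicts a minimum below $t$.
  · rw [Set.indicator_of_notMem hs]
    refine mul_eq_zero_of_right _ ?_
    refine (lintegral_congr fun u => ?_).trans lintegral_zero
    by_cases h2 : 0 ≤ bridge u + s • 1
    · have h3 := area_nonneg h2 (p + 1)
      rw [area_add, area_bridge_last, area_smul, area_const_one le_rfl, zero_add,
        mul_nonneg_iff_of_pos_right (l_pos p)] at h3
      have : ¬ s < t := fun h => hs ⟨lt_of_le_of_ne h3 hs0.symm, h⟩
      rw [Pi.mul_apply, hK]
      simp only [Set.indicator_of_notMem fun h => this ((hQs u).1 h).1, zero_mul, mul_zero]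
    · rw [Pi.mul_apply, Set.indicator_of_notMem h2, zero_mul]

/-- The decisive cancellation: $e^{s\cdot{\rm lastEntry}\,z}$ from the density of the past meets the
same exponential with opposite sign from `survival_neg`. The integrand is constant on the polytope,
and only its volume remains. -/
theorem measure_firstMin_succ [IsProbabilityMeasure P] (hX : ∀ i, Measurable (X i))
    (hlaw : ∀ i, HasLaw (X i) (expMeasure 1) P) (hindep : iIndepFun X P) (p m : ℕ) (t : ℝ) :
    P (firstMin X (p + 1 + (m + 1)) (p + 1) t) = ∫⁻ s in Set.Ioo 0 t,
      ENNReal.ofReal (c (p + 1) * s ^ p * Real.exp (-((p + 1) * s)) * Gn P X (m + 1) s) := by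
  rw [measure_firstMin hX hlaw hindep]
  refine setLIntegral_congr_fun measurableSet_Ioo fun s hs => ?_
  have h1 : ∫⁻ z in bridgeSet p, ENNReal.ofReal (Real.exp (s * lastEntry z - (p + 1) * s)) *
      survival (m + 1) s 0 (-(s * lastEntry z)) = ∫⁻ z in bridgeSet p,
        ENNReal.ofReal (Real.exp (-((p + 1) * s)) * Gn P X (m + 1) s) := by
    refine setLIntegral_congr_fun (measurableSet_bridgeSet p) fun z hz => ?_
    rw [survival_neg m hs.1.le (mul_nonneg hs.1.le (lastEntry_nonneg hz.1)),
      survival_zero_zero hX hlaw hindep, ← mul_assoc, ← ENNReal.ofReal_mul (Real.exp_pos _).le,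
      ← ENNReal.ofReal_mul (by positivity), ← Real.exp_add]
    congr 3; ring
  rw [h1, setLIntegral_const, c_succ, Measure.real, mul_comm (ENNReal.ofReal _) (volume _),
    ← mul_assoc, ← ENNReal.ofReal_toReal (volume_bridgeSet_lt_top p).ne]
  have := (l_pos p).le
  have := hs.1.le
  rw [← ENNReal.ofReal_mul (by positivity), ← ENNReal.ofReal_mul (by positivity),
    ENNReal.toReal_ofReal ENNReal.toReal_nonneg]
  congr 1; ring

theorem measure_firstMin_last [IsProbabilityMeasure P] (hX : ∀ i, Measurable (X i))
    (hlaw : ∀ i, HasLaw (X i) (expMeasure 1) P) (hindep : iIndepFun X P) (p : ℕ) (t : ℝ) :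
    P (firstMin X (p + 1) (p + 1) t) = ∫⁻ s in Set.Ioo 0 t, ENNReal.ofReal (lastDensity p s) := by
  have h := measure_firstMin hX hlaw hindep p 0 t
  rw [add_zero] at h
  rw [h]
  refine setLIntegral_congr_fun measurableSet_Ioo fun s hs => ?_
  rw [ofReal_lastDensity p hs.1.le]
  simp only [survival, mul_one]

theorem Gn_add_sum_firstMin [IsProbabilityMeasure P] (hX : ∀ i, Measurable (X i)) (n : ℕ) (t : ℝ) :
    Gn P X n t + ∑ p ∈ Finset.range n, P.real (firstMin X n (p + 1) t) = 1 := by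
  have hdisj : Set.PairwiseDisjoint (↑(Finset.range n)) fun p => firstMin X n (p + 1) t := by
    have key : ∀ p q, p < q → q < n →
        Disjoint (firstMin X n (p + 1) t) (firstMin X n (q + 1) t) := by
      intro p q hpq hq
      rw [Set.disjoint_left]
      rintro ω ⟨_, _, h1⟩ ⟨_, h2, _⟩
      have a := h1 (q + 1) (by rw [Finset.mem_Ioc]; omega)
      have b := h2 (p + 1) (by rw [Finset.mem_Ico]; omega)
      linarith
    intro p hp q hq hne
    simp only [Finset.coe_range, Set.mem_Iio] at hp hq
    rcases lt_or_gt_of_ne hne with h | h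
    · exact key p q h hq
    · exact (key q p h hp).symm
  rw [← measureReal_biUnion_finset hdisj fun p _ => measurableSet_firstMin hX _ _ _, Gn, Gn_set,
    ← measureReal_union (h₂ := measure_ne_top _ _)]
  · rw [← probReal_univ (μ := P)]
    congr 1
    ext ω
    simp only [Set.mem_union, Set.mem_ofPred_eq, Set.mem_iUnion, Finset.mem_range, Set.mem_univ,
      iff_true, or_iff_not_imp_left, not_forall, not_le]
    rintro ⟨k, hk, hlt⟩
    obtain ⟨i, hi, hmin⟩ := Finset.exists_min_image (Finset.Icc 1 n) (fun j => Y X j ω) ⟨k, hk⟩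
    have hex : ∃ i, i ∈ Finset.Icc 1 n ∧ ∀ j ∈ Finset.Icc 1 n, Y X i ω ≤ Y X j ω := ⟨i, hi, hmin⟩
    classical
    -- The least minimizer has strictly larger values before it, as `firstMin` requires.
    obtain ⟨h1, h2⟩ := Nat.find_spec hex
    have h3 : ∀ j, j < Nat.find hex → _ := fun j hj => Nat.find_min hex hj
    set r := Nat.find hex
    rw [Finset.mem_Icc] at h1
    refine ⟨r - 1, by omega, ?_⟩
    rw [Nat.sub_add_cancel h1.1]
    refine ⟨(h2 k hk).trans_lt hlt, fun j hj => ?_, fun j hj => ?_⟩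
    · rw [Finset.mem_Ico] at hj
      have hj' : j ∈ Finset.Icc 1 n := by rw [Finset.mem_Icc]; omega
      by_contra hcon
      exact h3 j hj.2 ⟨hj', fun i hi => (not_lt.1 hcon).trans (h2 i hi)⟩
    · rw [Finset.mem_Ioc] at hj
      exact h2 j (by rw [Finset.mem_Icc]; omega)
  · rw [Set.disjoint_left]
    intro ω h1 h2
    simp only [Set.mem_iUnion, Finset.mem_range] at h2
    obtain ⟨p, hp, h3, -⟩ := h2
    exact absurd (h1 (p + 1) (by rw [Finset.mem_Icc]; omega)) (not_le.2 h3)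
  · exact Finset.measurableSet_biUnion _ fun p _ => measurableSet_firstMin hX _ _ _

end

/-! ### Large deviations -/

section

variable {Ω : Type*} [MeasurableSpace Ω] {P : Measure Ω} {X : ℕ → Ω → ℝ}

theorem lintegral_exp_neg_mul_expMeasure {a : ℝ} (ha : 0 ≤ a) :
    ∫⁻ x, ENNReal.ofReal (Real.exp (-(a * x))) ∂expMeasure 1 = ENNReal.ofReal (1 / (1 + a)) := by
  rw [expMeasure_one_eq, lintegral_withDensity_eq_lintegral_mul _ (measurable_exponentialPDF 1)
    (by fun_prop)]
  have h : ∀ x : ℝ, (exponentialPDF 1 * fun x => ENNReal.ofReal (Real.exp (-(a * x)))) x =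
      ENNReal.ofReal (1 / (1 + a)) * exponentialPDF (1 + a) x := by
    intro x
    rw [Pi.mul_apply]
    rcases lt_or_ge x 0 with hx | hx
    · rw [exponentialPDF_of_neg hx, exponentialPDF_of_neg hx, zero_mul, mul_zero]
    · rw [exponentialPDF_of_nonneg hx, exponentialPDF_of_nonneg hx,
        ← ENNReal.ofReal_mul (by positivity), ← ENNReal.ofReal_mul (by positivity)]
      congr 1
      rw [one_mul, ← Real.exp_add, ← mul_assoc, one_div, inv_mul_cancel₀ (by positivity), one_mul]
      ring_nf
  rw [lintegral_congr h, lintegral_const_mul _ (measurable_exponentialPDF _),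
    lintegral_exponentialPDF_eq_one (by positivity), mul_one]

theorem areaSum_eq_sum {Ω : Type*} (X : ℕ → Ω → ℝ) (n : ℕ) (ω : Ω) :
    areaSum X n ω = ∑ i : Fin n, ((n - (i : ℕ) : ℕ) : ℝ) * X i ω :=
  (area_past X le_rfl ω).symm

theorem lintegral_exp_neg_areaSum [IsProbabilityMeasure P] (hX : ∀ i, Measurable (X i))
    (hlaw : ∀ i, HasLaw (X i) (expMeasure 1) P) (hindep : iIndepFun X P) (n : ℕ) {a : ℝ}
    (ha : 0 ≤ a) :
    ∫⁻ ω, ENNReal.ofReal (Real.exp (-(a * areaSum X n ω))) ∂P =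
      ∏ i : Fin n, ENNReal.ofReal (1 / (1 + a * (n - (i : ℕ) : ℕ))) := by
  have h1 : ∀ ω, ENNReal.ofReal (Real.exp (-(a * areaSum X n ω))) =
      ∏ i : Fin n, ENNReal.ofReal (Real.exp (-((a * (n - (i : ℕ) : ℕ)) * X i ω))) := by
    intro ω
    rw [← ENNReal.ofReal_prod_of_nonneg fun i _ => (Real.exp_pos _).le, ← Real.exp_sum,
      areaSum_eq_sum, Finset.mul_sum, ← Finset.sum_neg_distrib]
    congr 3
    funext i
    ring
  have hi : iIndepFun (fun (i : Fin n) ω =>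
      ENNReal.ofReal (Real.exp (-((a * (n - (i : ℕ) : ℕ)) * X i ω)))) P :=
    (hindep.precomp (g := fun i : Fin n => (i : ℕ)) Fin.val_injective).comp
      (fun (i : Fin n) x => ENNReal.ofReal (Real.exp (-((a * (n - (i : ℕ) : ℕ)) * x))))
      fun i => by fun_prop
  rw [lintegral_congr h1, lintegral_prod_eq_prod_lintegral_of_indepFun Finset.univ _ hi
    fun i => by have := hX i; fun_prop]
  refine Finset.prod_congr rfl fun i _ => ?_
  rw [← lintegral_exp_neg_mul_expMeasure (by positivity), ← (hlaw i).map_eq,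
    lintegral_map (by fun_prop) (hX i)]

theorem one_div_one_add_le {x : ℝ} (hx : 0 ≤ x) : 1 / (1 + x) ≤ Real.exp (-(x - x ^ 2)) := by
  have h : 1 - x / (1 + x) ≤ Real.exp (-(x / (1 + x))) := by
    linarith [Real.add_one_le_exp (-(x / (1 + x)))]
  calc 1 / (1 + x) = 1 - x / (1 + x) := by field_simp; ring
    _ ≤ Real.exp (-(x / (1 + x))) := h
    _ ≤ _ := by
      rw [Real.exp_le_exp, neg_le_neg_iff, le_div_iff₀ (by positivity)]
      nlinarith [pow_nonneg hx 3]

/-- Chernoff bound for the lower tail of the area. -/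
theorem measureReal_Y_le [IsProbabilityMeasure P] (hX : ∀ i, Measurable (X i))
    (hlaw : ∀ i, HasLaw (X i) (expMeasure 1) P) (hindep : iIndepFun X P) {n : ℕ} (hn : 1 ≤ n)
    {r : ℝ} (hr : r ≤ 1) :
    P.real {ω | Y X n ω ≤ r} ≤ Real.exp (-((1 - r) ^ 2 / 8 * (n + 1))) := by
  have hn0 : (0 : ℝ) < n := by exact_mod_cast hn
  -- With $a=\delta/n$ every $x=a(n-i)$ is at most $\delta$, so $x-x^2\ge(1-\delta)x$. As
  -- $1-\delta-r=\delta$, the exponent becomes $a\,l_n\delta=\delta^2(n+1)/2$.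
  set δ := (1 - r) / 2 with hδ
  have hδ0 : 0 ≤ δ := by rw [hδ]; linarith
  set a := δ / n with ha
  have ha0 : 0 ≤ a := by positivity
  have hl : 0 < l n := by unfold l; positivity
  have hsum1 : ∑ i : Fin n, ((n - (i : ℕ) : ℕ) : ℝ) = l n := by
    have := area_const_one (le_refl n)
    simpa [area] using this
  have hbound : ∏ i : Fin n, ENNReal.ofReal (1 / (1 + a * (n - (i : ℕ) : ℕ))) ≤
      ENNReal.ofReal (Real.exp (-(a * l n * (1 - δ)))) := by
    calc _ ≤ ∏ i : Fin n, ENNReal.ofReal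
          (Real.exp (-(a * (1 - δ) * (n - (i : ℕ) : ℕ)))) := by
          refine Finset.prod_le_prod' fun i _ => ENNReal.ofReal_le_ofReal ?_
          refine (one_div_one_add_le (by positivity)).trans ?_
          rw [Real.exp_le_exp, neg_le_neg_iff]
          have h1 : ((n - (i : ℕ) : ℕ) : ℝ) ≤ n := by exact_mod_cast Nat.sub_le _ _
          have h2 : a * ((n - (i : ℕ) : ℕ) : ℝ) ≤ δ := by
            calc a * ((n - (i : ℕ) : ℕ) : ℝ) ≤ a * n := by gcongr
              _ = δ := by rw [ha]; field_simp
          have h3 : 0 ≤ a * ((n - (i : ℕ) : ℕ) : ℝ) := by positivity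
          nlinarith
      _ = _ := by
          rw [← ENNReal.ofReal_prod_of_nonneg fun i _ => (Real.exp_pos _).le, ← Real.exp_sum,
            Finset.sum_neg_distrib, ← Finset.mul_sum, hsum1]
          congr 3; ring
  have hmarkov : P {ω | Y X n ω ≤ r} ≤
      ENNReal.ofReal (Real.exp (a * (r * l n))) * ENNReal.ofReal
        (Real.exp (-(a * l n * (1 - δ)))) := by
    refine le_trans ?_ (mul_le_mul_right hbound _)
    have hm : Measurable fun ω => ENNReal.ofReal (Real.exp (-(a * areaSum X n ω))) := by
      have := measurable_areaSum hX n
      fun_prop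
    rw [← lintegral_exp_neg_areaSum hX hlaw hindep n ha0, ← lintegral_const_mul _ hm,
      ← lintegral_indicator_one (measurableSet_le (measurable_Y hX n) measurable_const)]
    refine lintegral_mono fun ω => ?_
    by_cases hω : Y X n ω ≤ r
    · rw [Set.indicator_of_mem (show ω ∈ {ω | Y X n ω ≤ r} from hω), ← ENNReal.ofReal_mul
        (Real.exp_pos _).le, ← Real.exp_add, Pi.one_apply, ENNReal.one_le_ofReal, Real.one_le_exp_iff]
      rw [Y_eq_div, div_le_iff₀ hl] at hω
      have := mul_le_mul_of_nonneg_left hω ha0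
      linarith
    · rw [Set.indicator_of_notMem (show ω ∉ {ω | Y X n ω ≤ r} from hω)]; exact zero_le
  have := ENNReal.toReal_mono (ENNReal.mul_ne_top ENNReal.ofReal_ne_top ENNReal.ofReal_ne_top)
    hmarkov
  refine this.trans (le_of_eq ?_)
  rw [ENNReal.toReal_mul, ENNReal.toReal_ofReal (Real.exp_pos _).le,
    ENNReal.toReal_ofReal (Real.exp_pos _).le, ← Real.exp_add]
  congr 1
  rw [ha, hδ, l]
  field_simp
  ring

/-- Raising the first increment by $\theta\in[0,1]$ lowers the density by at most a factor $e$ and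
raises $Y_{p+1}$ by at most $(p+1)/l_{p+1}=2/(p+2)$. The prefactor $(p+2)/2$ is $l_{p+1}$ divided by
the slab Jacobian $p+1$. -/
theorem lastDensity_le [IsProbabilityMeasure P] (hX : ∀ i, Measurable (X i))
    (hlaw : ∀ i, HasLaw (X i) (expMeasure 1) P) (hindep : iIndepFun X P) {p : ℕ} (hp : p ≠ 0)
    {s : ℝ} (hs : 0 ≤ s) :
    lastDensity p s ≤ Real.exp 1 * ((p + 2) / 2) *
      P.real {ω | Y X (p + 1) ω ≤ s + 2 / (p + 2)} := by
  rcases hs.eq_or_lt with rfl | hs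
  -- Rescaling the slice needs $s>0$; at $s=0$ the factor $s^p$ kills the left side because $p\ne0$.
  · rw [lastDensity, zero_pow hp]
    simp only [mul_zero, zero_mul]
    positivity
  set Q : Set (Fin (p + 1) → ℝ) := {x | area x (p + 1) ≤ s * l (p + 1) + (p + 1)} with hQ
  have hQm : MeasurableSet Q :=
    measurableSet_le (continuous_area _).measurable measurable_const
  have hpos : MeasurableSet {x : Fin (p + 1) → ℝ | 0 ≤ x} :=
    (isClosed_le continuous_const continuous_id).measurableSet
  have hexpm : Measurable fun x : Fin (p + 1) → ℝ => ENNReal.ofReal (Real.exp (-∑ i, x i)) := by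
    fun_prop
  have hprob : P {ω | Y X (p + 1) ω ≤ s + 2 / (p + 2)} = ∫⁻ x : Fin (p + 1) → ℝ,
      {x : Fin (p + 1) → ℝ | 0 ≤ x}.indicator (fun x => ENNReal.ofReal (Real.exp (-∑ i, x i))) x *
        Q.indicator 1 x := by
    rw [← lintegral_past hX hlaw hindep (p + 1) (measurable_one.indicator hQm),
      ← lintegral_indicator_one (measurableSet_le (measurable_Y hX _) measurable_const)]
    refine lintegral_congr fun ω => ?_
    have : past X (p + 1) ω ∈ Q ↔ ω ∈ {ω | Y X (p + 1) ω ≤ s + 2 / (p + 2)} := by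
      simp only [hQ, Set.mem_ofPred_eq, area_past X le_rfl, Y_eq_div, div_le_iff₀ (l_pos p)]
      have : (s + 2 / ((p : ℝ) + 2)) * l (p + 1) = s * l (p + 1) + (p + 1) := by
        rw [l]; push_cast; field_simp; ring
      rw [this]
    by_cases hω : ω ∈ {ω | Y X (p + 1) ω ≤ s + 2 / (p + 2)}
    · rw [Set.indicator_of_mem hω, Set.indicator_of_mem (this.2 hω)]; rfl
    · rw [Set.indicator_of_notMem hω, Set.indicator_of_notMem fun h => hω (this.1 h)]
  have hslice := slice_le_lintegral ((hexpm.indicator hpos).mul (measurable_one.indicator hQm)) s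
    (F := {u : Fin p → ℝ | 0 ≤ u ∧ 0 ≤ bridge u + s • 1}.indicator
      fun u => ENNReal.ofReal (Real.exp (lastEntry u - (p + 1) * s - 1))) (by
    intro u θ hθ
    by_cases hu : u ∈ {u : Fin p → ℝ | 0 ≤ u ∧ 0 ≤ bridge u + s • 1}
    · have hx : bridge u + θ • Pi.single 0 1 + s • 1 ∈ {x : Fin (p + 1) → ℝ | 0 ≤ x} := by
        intro i
        have h1 := hu.2 i
        have h2 : 0 ≤ θ * (Pi.single 0 1 : Fin (p + 1) → ℝ) i :=
          mul_nonneg hθ.1 (by rw [Pi.single_apply]; split_ifs <;> norm_num)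
        simp only [Pi.add_apply, Pi.smul_apply, smul_eq_mul, Pi.one_apply, Pi.zero_apply] at h1 ⊢
        linarith
      have hxQ : bridge u + θ • Pi.single 0 1 + s • 1 ∈ Q := by
        rw [hQ, Set.mem_ofPred_eq, area_add, area_add, area_bridge_last, area_smul, area_smul,
          area_single, area_const_one le_rfl]
        push_cast
        nlinarith [hθ.2, Nat.cast_nonneg (α := ℝ) p]
      rw [Pi.mul_apply, Set.indicator_of_mem hu, Set.indicator_of_mem hx,
        Set.indicator_of_mem hxQ, Pi.one_apply, mul_one]
      refine ENNReal.ofReal_le_ofReal (Real.exp_le_exp.2 ?_)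
      simp only [Pi.add_apply, Finset.sum_add_distrib, sum_bridge, Pi.smul_apply, smul_eq_mul,
        ← Finset.mul_sum, Finset.sum_pi_single']
      simp
      nlinarith [hθ.2]
    · rw [Set.indicator_of_notMem hu]; exact zero_le)
  simp only [Pi.mul_apply] at hslice
  have hlm : Measurable (lastEntry : (Fin p → ℝ) → ℝ) := (continuous_lastEntry p).measurable
  rw [← hprob, lintegral_smul_bridgeSet hs (by fun_prop)] at hslice
  have hfac : ∀ z : Fin p → ℝ,
      ENNReal.ofReal (Real.exp (lastEntry (s • z) - (p + 1) * s - 1)) =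
        ENNReal.ofReal (Real.exp (-1)) *
          ENNReal.ofReal (Real.exp (s * lastEntry z - (p + 1) * s)) := fun z => by
    rw [← ENNReal.ofReal_mul (Real.exp_pos _).le, ← Real.exp_add, lastEntry_smul]
    congr 2; ring
  rw [lintegral_congr hfac, lintegral_const_mul _ (by fun_prop)] at hslice
  have hD : ENNReal.ofReal (lastDensity p s) ≤ ENNReal.ofReal (Real.exp 1 * ((p + 2) / 2)) *
      P {ω | Y X (p + 1) ω ≤ s + 2 / (p + 2)} := by
    refine le_trans (le_of_eq ?_) (mul_le_mul_right hslice _)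
    rw [ofReal_lastDensity p hs.le]
    simp only [← mul_assoc]
    congr 1
    rw [← ENNReal.ofReal_mul (by positivity), ← ENNReal.ofReal_mul (by positivity),
      ← ENNReal.ofReal_mul (by positivity)]
    congr 1
    have he : Real.exp 1 * Real.exp (-1) = 1 := by rw [← Real.exp_add]; simp
    calc l (p + 1) * s ^ p = (Real.exp 1 * Real.exp (-1)) * (l (p + 1) * s ^ p) := by
          rw [he, one_mul]
      _ = _ := by rw [l]; push_cast; ring
  have := ENNReal.toReal_mono (ENNReal.mul_ne_top ENNReal.ofReal_ne_top (measure_ne_top _ _)) hD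
  rwa [ENNReal.toReal_ofReal (lastDensity_nonneg p hs.le), ENNReal.toReal_mul,
    ENNReal.toReal_ofReal (by positivity)] at this

end

/-! ### Calculus on half-lines and intervals -/

theorem toReal_setLIntegral_Ioo {f : ℝ → ℝ} (hf : ContinuousOn f (Set.Ici 0))
    (h0 : ∀ s, 0 ≤ s → 0 ≤ f s) {t : ℝ} (ht : 0 ≤ t) :
    (∫⁻ s in Set.Ioo 0 t, ENNReal.ofReal (f s)).toReal = ∫ s in 0..t, f s := by
  have hc : ContinuousOn f (Set.Icc 0 t) := hf.mono Set.Icc_subset_Ici_self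
  have hi : IntegrableOn f (Set.Ioo 0 t) :=
    hc.integrableOn_Icc.mono_set Set.Ioo_subset_Icc_self
  have hn : ∀ᵐ s ∂volume.restrict (Set.Ioo 0 t), 0 ≤ f s :=
    (ae_restrict_iff' measurableSet_Ioo).2 (ae_of_all _ fun s hs => h0 s hs.1.le)
  rw [← ofReal_integral_eq_lintegral_ofReal hi hn, ENNReal.toReal_ofReal (integral_nonneg_of_ae hn),
    intervalIntegral.integral_of_le ht, integral_Ioc_eq_integral_Ioo]

/-- Extending `f` by constants beyond the interval reduces one-sided derivatives at the endpoints to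
the two-sided fundamental theorem. -/
theorem hasDerivWithinAt_of_eq_integral {f g : ℝ → ℝ} {a b : ℝ} (hb : 0 ≤ b)
    (hf : ContinuousOn f (Set.Icc 0 b)) (hg : ∀ t ∈ Set.Icc 0 b, g t = a + ∫ s in 0..t, f s)
    {t : ℝ} (ht : t ∈ Set.Icc 0 b) : HasDerivWithinAt g (f t) (Set.Icc 0 b) t := by
  set F : ℝ → ℝ := Set.IccExtend hb (Set.domRestrict (Set.Icc 0 b) f) with hF
  have hFc : Continuous F := (continuousOn_iff_continuous_domRestrict.1 hf).Icc_extend'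
  have hFf : ∀ s ∈ Set.Icc 0 b, F s = f s := fun s hs => by
    rw [hF, Set.IccExtend_of_mem hb _ hs]; rfl
  have hd : HasDerivAt (fun t => a + ∫ s in 0..t, F s) (F t) t :=
    (hFc.integral_hasStrictDerivAt 0 t).hasDerivAt.const_add a
  rw [hFf t ht] at hd
  have heq : ∀ t ∈ Set.Icc 0 b, g t = a + ∫ s in 0..t, F s := fun t ht => by
    rw [hg t ht]
    congr 1
    refine intervalIntegral.integral_congr fun s hs => ?_
    rw [Set.uIcc_of_le ht.1] at hs
    exact (hFf s ⟨hs.1, hs.2.trans ht.2⟩).symm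
  exact hd.hasDerivWithinAt.congr heq (heq t ht)

theorem contDiffOn_one_of_hasDerivWithinAt {f g : ℝ → ℝ} {s : Set ℝ} (hs : UniqueDiffOn ℝ s)
    (hf : ContinuousOn f s) (hg : ∀ t ∈ s, HasDerivWithinAt g (f t) s t) : ContDiffOn ℝ 1 g s := by
  rw [contDiffOn_one_iff_derivWithin hs]
  exact ⟨fun t ht => (hg t ht).differentiableWithinAt,
    hf.congr fun t ht => (hg t ht).derivWithin (hs t ht)⟩

/-- Makes the series at `b` a majorant for all $t\in[0,b]$ at once; the inequality behind it is
$(1-b)(b-t)\ge0$. -/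
theorem mul_exp_neg_le {t b : ℝ} (htb : t ≤ b) (hb0 : 0 < b) (hb : b ≤ 1) :
    t * Real.exp (-t) ≤ b * Real.exp (-b) := by
  have h1 : t ≤ b * Real.exp (t - b) := by
    have h2 : b * (t - b + 1) ≤ b * Real.exp (t - b) :=
      mul_le_mul_of_nonneg_left (Real.add_one_le_exp _) hb0.le
    nlinarith
  calc t * Real.exp (-t) ≤ b * Real.exp (t - b) * Real.exp (-t) := by gcongr
    _ = b * Real.exp (-b) := by rw [mul_assoc, ← Real.exp_add]; congr 2; ring

/-! ### The derivatives of `G_n` and their limit -/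

/-- The function `-G_{N+1}'`. -/
def negDeriv {Ω : Type*} [MeasurableSpace Ω] (P : Measure Ω) (X : ℕ → Ω → ℝ) (N : ℕ) (s : ℝ) : ℝ :=
  ∑ p ∈ Finset.range N, c (p + 1) * s ^ p * Real.exp (-((p + 1) * s)) * Gn P X (N - p) s +
    lastDensity N s

theorem Y_congr {Ω : Type*} {X X' : ℕ → Ω → ℝ} {ω : Ω} (h : ∀ i, X i ω = X' i ω) (k : ℕ) :
    Y X k ω = Y X' k ω := by
  simp only [Y, S, h]

section

variable {Ω : Type*} [MeasurableSpace Ω] {P : Measure Ω} {X : ℕ → Ω → ℝ}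

theorem Gn_nonneg (n : ℕ) (t : ℝ) : 0 ≤ Gn P X n t := measureReal_nonneg

theorem Gn_succ_eq [IsProbabilityMeasure P] (hX : ∀ i, Measurable (X i))
    (hlaw : ∀ i, HasLaw (X i) (expMeasure 1) P) (hindep : iIndepFun X P) (N : ℕ)
    (hcont : ∀ m ≤ N, ContinuousOn (Gn P X m) (Set.Ici 0)) {t : ℝ} (ht : 0 ≤ t) :
    Gn P X (N + 1) t = 1 - ∫ s in 0..t, negDeriv P X N s := by
  have h := Gn_add_sum_firstMin (P := P) hX (N + 1) t
  rw [Finset.sum_range_succ] at h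
  have hc : ∀ p ∈ Finset.range N, ContinuousOn
      (fun s => c (p + 1) * s ^ p * Real.exp (-((p + 1) * s)) * Gn P X (N - p) s)
      (Set.Ici 0) := fun p _ =>
    ContinuousOn.mul (Continuous.continuousOn (by fun_prop)) (hcont _ (Nat.sub_le _ _))
  have hterm : ∀ p ∈ Finset.range N, P.real (firstMin X (N + 1) (p + 1) t) =
      ∫ s in 0..t, c (p + 1) * s ^ p * Real.exp (-((p + 1) * s)) * Gn P X (N - p) s := by
    intro p hp
    rw [← toReal_setLIntegral_Ioo (hc p hp) (fun s hs => ?_) ht]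
    · rw [Finset.mem_range] at hp
      -- Since $p<N$, at least one step follows the minimum, so the cancellation formula is
      -- available.
      obtain ⟨m, rfl⟩ : ∃ m, N = p + m + 1 := ⟨N - p - 1, by omega⟩
      have := measure_firstMin_succ hX hlaw hindep p m t
      rw [show p + 1 + (m + 1) = p + m + 1 + 1 by ring] at this
      rw [Measure.real, this, show p + m + 1 - p = m + 1 by omega]
    · have := (c_pos p).le
      have := Gn_nonneg (P := P) (X := X) (N - p) s
      positivity
  have hlast : P.real (firstMin X (N + 1) (N + 1) t) = ∫ s in 0..t, lastDensity N s := by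
    rw [← toReal_setLIntegral_Ioo (continuous_lastDensity N).continuousOn
      (fun s hs => lastDensity_nonneg N hs) ht, ← measure_firstMin_last hX hlaw hindep]
    rfl
  have hint : ∀ p ∈ Finset.range N, IntervalIntegrable
      (fun s => c (p + 1) * s ^ p * Real.exp (-((p + 1) * s)) * Gn P X (N - p) s) volume 0 t :=
    fun p hp => ContinuousOn.intervalIntegrable
      ((hc p hp).mono (by rw [Set.uIcc_of_le ht]; exact Set.Icc_subset_Ici_self))
  rw [Finset.sum_congr rfl hterm, hlast, ← intervalIntegral.integral_finsetSum hint] at h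
  unfold negDeriv
  rw [intervalIntegral.integral_add (ContinuousOn.intervalIntegrable
    ((continuousOn_finsetSum _ hc).mono (by rw [Set.uIcc_of_le ht]; exact Set.Icc_subset_Ici_self)))
    ((continuous_lastDensity N).intervalIntegrable _ _)]
  linarith

theorem continuousOn_negDeriv_of {N : ℕ}
    (hcont : ∀ m ≤ N, ContinuousOn (Gn P X m) (Set.Ici 0)) :
    ContinuousOn (negDeriv P X N) (Set.Ici 0) := by
  unfold negDeriv
  refine ContinuousOn.add (continuousOn_finsetSum _ fun p _ => ?_)
    (continuous_lastDensity N).continuousOn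
  exact ContinuousOn.mul (Continuous.continuousOn (by fun_prop)) (hcont _ (Nat.sub_le _ _))

theorem hasDerivWithinAt_Gn_of [IsProbabilityMeasure P] (hX : ∀ i, Measurable (X i))
    (hlaw : ∀ i, HasLaw (X i) (expMeasure 1) P) (hindep : iIndepFun X P) {N : ℕ}
    (hcont : ∀ m ≤ N, ContinuousOn (Gn P X m) (Set.Ici 0)) {t : ℝ} (ht : 0 ≤ t) :
    HasDerivWithinAt (Gn P X (N + 1)) (-negDeriv P X N t) (Set.Ici 0) t := by
  have h := hasDerivWithinAt_of_eq_integral (f := fun s => -negDeriv P X N s)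
    (g := Gn P X (N + 1)) (a := 1) (b := t + 1) (by linarith)
    ((continuousOn_negDeriv_of hcont).neg.mono Set.Icc_subset_Ici_self)
    (fun s hs => by
      rw [Gn_succ_eq hX hlaw hindep N hcont hs.1, intervalIntegral.integral_neg]; ring)
    (t := t) ⟨ht, by linarith⟩
  refine h.mono_of_mem_nhdsWithin ?_
  rw [← Set.Ici_inter_Iic]
  exact inter_mem_nhdsWithin _ (Iic_mem_nhds (by linarith))

/-- The integrand for $G_{N+1}$ contains only $G_m$ with $m\le N$, so strong induction closes. -/
theorem continuousOn_Gn [IsProbabilityMeasure P] (hX : ∀ i, Measurable (X i))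
    (hlaw : ∀ i, HasLaw (X i) (expMeasure 1) P) (hindep : iIndepFun X P) (n : ℕ) :
    ContinuousOn (Gn P X n) (Set.Ici 0) := by
  induction n using Nat.strong_induction_on with
  | _ n ih =>
    rcases n with _ | N
    · have : Gn P X 0 = fun _ => 1 := by
        funext t
        simp [Gn]
      rw [this]
      exact continuousOn_const
    · exact fun t ht => (hasDerivWithinAt_Gn_of hX hlaw hindep
        (fun m hm => ih m (by omega)) ht).continuousWithinAt

theorem continuousOn_negDeriv [IsProbabilityMeasure P] (hX : ∀ i, Measurable (X i))
    (hlaw : ∀ i, HasLaw (X i) (expMeasure 1) P) (hindep : iIndepFun X P) (N : ℕ) :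
    ContinuousOn (negDeriv P X N) (Set.Ici 0) :=
  continuousOn_negDeriv_of fun m _ => continuousOn_Gn hX hlaw hindep m

theorem hasDerivWithinAt_Gn [IsProbabilityMeasure P] (hX : ∀ i, Measurable (X i))
    (hlaw : ∀ i, HasLaw (X i) (expMeasure 1) P) (hindep : iIndepFun X P) (N : ℕ) {t : ℝ}
    (ht : 0 ≤ t) :
    HasDerivWithinAt (Gn P X (N + 1)) (-negDeriv P X N t) (Set.Ici 0) t :=
  hasDerivWithinAt_Gn_of hX hlaw hindep (fun m _ => continuousOn_Gn hX hlaw hindep m) ht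

/-! ### Uniform estimates on $[0,b]$ with $b<1$. -/

/-- The probability that some `Y_k` with `k > m` is at most `b`. -/
def tailProb {Ω : Type*} [MeasurableSpace Ω] (P : Measure Ω) (X : ℕ → Ω → ℝ) (b : ℝ) (m : ℕ) : ℝ :=
  P.real (⋃ k, {ω | Y X (k + m + 1) ω ≤ b})

/-- The two events differ only if some $Y_k$ with $k>m$ falls below $t\le b$; the bound is therefore
uniform in $t$. -/
theorem abs_Gn_sub_G_le [IsProbabilityMeasure P] (hX : ∀ i, Measurable (X i)) {b t : ℝ}
    (htb : t ≤ b) (m : ℕ) : |Gn P X m t - G P X t| ≤ tailProb P X b m := by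
  rw [Gn, G, Gn_set, G_set]
  have hsub : {ω | ∀ k, 1 ≤ k → t ≤ Y X k ω} ⊆ {ω | ∀ k ∈ Finset.Icc 1 m, t ≤ Y X k ω} :=
    fun ω h k hk => h k (Finset.mem_Icc.1 hk).1
  have hm : MeasurableSet {ω | ∀ k, 1 ≤ k → t ≤ Y X k ω} := by
    simp only [Set.ofPred_forall]
    exact MeasurableSet.iInter fun k => MeasurableSet.iInter fun _ =>
      measurableSet_le measurable_const (measurable_Y hX k)
  rw [abs_of_nonneg (sub_nonneg.2 (measureReal_mono hsub)), ← measureReal_sdiff hsub hm]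
  refine measureReal_mono ?_
  rintro ω ⟨h1, h2⟩
  simp only [Set.mem_ofPred_eq, not_forall, not_le] at h1 h2
  obtain ⟨k, hk, hlt⟩ := h2
  have hkm : m < k := by
    by_contra hcon
    exact absurd (h1 k (Finset.mem_Icc.2 ⟨hk, not_lt.1 hcon⟩)) (not_le.2 hlt)
  refine Set.mem_iUnion.2 ⟨k - m - 1, ?_⟩
  rw [Set.mem_ofPred_eq, show k - m - 1 + m + 1 = k by omega]
  linarith

theorem tendsto_tailProb [IsProbabilityMeasure P] (hX : ∀ i, Measurable (X i))
    (hlaw : ∀ i, HasLaw (X i) (expMeasure 1) P) (hindep : iIndepFun X P) {b : ℝ} (hb : b < 1) :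
    Tendsto (tailProb P X b) atTop (𝓝 0) := by
  set κ := (1 - b) ^ 2 / 8 with hκ
  have hκ0 : 0 < κ := by have := sub_pos.2 hb; positivity
  set f : ℕ → ℝ≥0∞ := fun k => P {ω | Y X (k + 1) ω ≤ b} with hf
  have hle : ∀ k, f k ≤ ENNReal.ofReal (Real.exp (-κ) ^ k) := by
    intro k
    rw [hf]
    simp only
    rw [← ENNReal.ofReal_toReal (measure_ne_top P _)]
    refine ENNReal.ofReal_le_ofReal
      ((measureReal_Y_le hX hlaw hindep (by omega) hb.le).trans ?_)
    rw [← Real.exp_nat_mul, Real.exp_le_exp]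
    push_cast
    nlinarith
  have hsum : ∑' k, f k ≠ ∞ := by
    refine ne_top_of_le_ne_top ?_ (ENNReal.tsum_le_tsum hle)
    rw [← ENNReal.ofReal_tsum_of_nonneg (fun k => by positivity)]
    · exact ENNReal.ofReal_ne_top
    · exact summable_geometric_of_lt_one (Real.exp_pos _).le (by simpa using hκ0)
  have ht := (ENNReal.tendsto_toReal ENNReal.zero_ne_top).comp (ENNReal.tendsto_sum_nat_add f hsum)
  rw [ENNReal.toReal_zero] at ht
  refine squeeze_zero (fun m => measureReal_nonneg) (fun m => ?_) ht
  have hne : ∑' k, f (k + m) ≠ ∞ :=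
    ne_top_of_le_ne_top hsum (ENNReal.tsum_comp_le_tsum_of_injective (add_left_injective m) f)
  exact ENNReal.toReal_mono hne (measure_iUnion_le _)

theorem tailProb_le_one [IsProbabilityMeasure P] (b : ℝ) (m : ℕ) : tailProb P X b m ≤ 1 :=
  measureReal_le_one

theorem tendsto_lastDensity_bound [IsProbabilityMeasure P] (hX : ∀ i, Measurable (X i))
    (hlaw : ∀ i, HasLaw (X i) (expMeasure 1) P) (hindep : iIndepFun X P) {b : ℝ} (hb : b < 1) :
    ∃ e : ℕ → ℝ, Tendsto e atTop (𝓝 0) ∧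
      ∀ᶠ N in atTop, ∀ t ∈ Set.Icc 0 b, lastDensity N t ≤ e N := by
  -- The Chernoff rate at the midpoint of $b$ and $1$, which absorbs the shift $2/(N+2)$ once that
  -- is at most $(1-b)/2$.
  set κ := (1 - (1 + b) / 2) ^ 2 / 8 with hκ
  have hκ0 : 0 < κ := by
    have : 0 < 1 - (1 + b) / 2 := by linarith
    positivity
  refine ⟨fun N => Real.exp 1 / 2 * (((N + 2 : ℕ) : ℝ) ^ 1 * Real.exp (-κ) ^ (N + 2)), ?_, ?_⟩
  · have h := tendsto_pow_const_mul_const_pow_of_abs_lt_one 1 (r := Real.exp (-κ))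
      (by rw [abs_of_pos (Real.exp_pos _)]; simpa using hκ0)
    have h2 := ((tendsto_add_atTop_iff_nat 2).2 h).const_mul (Real.exp 1 / 2)
    simpa using h2
  · have hlim : Tendsto (fun N : ℕ => 2 / ((N : ℝ) + 2)) atTop (𝓝 0) :=
      Tendsto.div_atTop tendsto_const_nhds
        (tendsto_atTop_add_const_right _ _ tendsto_natCast_atTop_atTop)
    filter_upwards [eventually_ge_atTop 1, hlim.eventually_le_const
      (show (0 : ℝ) < (1 - b) / 2 by linarith)] with N hN1 hN t ht
    refine (lastDensity_le hX hlaw hindep (by omega) ht.1).trans ?_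
    have h1 : P.real {ω | Y X (N + 1) ω ≤ t + 2 / (N + 2)} ≤
        P.real {ω | Y X (N + 1) ω ≤ (1 + b) / 2} :=
      measureReal_mono fun ω hω =>
        (show Y X (N + 1) ω ≤ t + 2 / (N + 2) from hω).trans (by linarith [ht.2])
    have h2 := measureReal_Y_le hX hlaw hindep (n := N + 1) (by omega)
      (show (1 + b) / 2 ≤ 1 by linarith)
    calc Real.exp 1 * (((N : ℝ) + 2) / 2) * P.real {ω | Y X (N + 1) ω ≤ t + 2 / (N + 2)}
        ≤ Real.exp 1 * (((N : ℝ) + 2) / 2) * Real.exp (-(κ * ((N + 1 : ℕ) + 1))) := by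
          gcongr
          exact h1.trans h2
      _ = _ := by
          rw [← Real.exp_nat_mul, pow_one]
          push_cast
          rw [show -(κ * ((N : ℝ) + 1 + 1)) = ((N : ℝ) + 2) * -κ by ring]
          ring

/-- Dominated convergence for series: the finite sum and the limiting series differ termwise by at
most `M p * d N p`, with `M` summable and `d N p → 0` for each `p`. -/
theorem exists_bound_negDeriv [IsProbabilityMeasure P] (hX : ∀ i, Measurable (X i))
    (hlaw : ∀ i, HasLaw (X i) (expMeasure 1) P) (hindep : iIndepFun X P) {b : ℝ} (hb0 : 0 < b)
    (hb : b < 1) :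
    ∃ e : ℕ → ℝ, Tendsto e atTop (𝓝 0) ∧
      ∀ᶠ N in atTop, ∀ t ∈ Set.Icc 0 b, |-negDeriv P X N t - rhs P X t| ≤ e N := by
  obtain ⟨e₁, he₁, hlast⟩ := tendsto_lastDensity_bound hX hlaw hindep hb
  set M : ℕ → ℝ := fun p => c (p + 1) * (b * Real.exp (-b)) ^ p with hM
  have hMs : Summable M := summable_c_mul_exp ⟨hb0.le, hb⟩
  have hM0 : ∀ p, 0 ≤ M p := fun p => mul_nonneg (c_pos p).le (by positivity)
  -- For $p\ge N$ the finite sum has no term, and the error is $G$ itself, which is at most $1$.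
  set d : ℕ → ℕ → ℝ := fun N p => if p < N then tailProb P X b (N - p) else 1 with hd
  have hd0 : ∀ N p, 0 ≤ d N p := fun N p => by
    rw [hd]; simp only; split_ifs
    · exact measureReal_nonneg
    · exact zero_le_one
  have hd1 : ∀ N p, d N p ≤ 1 := fun N p => by
    rw [hd]; simp only; split_ifs
    · exact tailProb_le_one b _
    · exact le_rfl
  have hMd : ∀ N, Summable fun p => M p * d N p := fun N =>
    Summable.of_nonneg_of_le (fun p => mul_nonneg (hM0 p) (hd0 N p))
      (fun p => mul_le_of_le_one_right (hM0 p) (hd1 N p)) hMs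
  refine ⟨fun N => ∑' p, M p * d N p + e₁ N, ?_, ?_⟩
  · have h : Tendsto (fun N => ∑' p, M p * d N p) atTop (𝓝 (∑' _ : ℕ, (0 : ℝ))) := by
      refine tendsto_tsum_of_dominated_convergence hMs (fun p => ?_)
        (Eventually.of_forall fun N p => ?_)
      · have h1 : Tendsto (fun N => d N p) atTop (𝓝 0) := by
          refine Tendsto.congr' ?_ ((tendsto_tailProb hX hlaw hindep hb).comp
            (tendsto_sub_atTop_nat p))
          filter_upwards [eventually_gt_atTop p] with N hN
          simp [hd, hN]
        simpa using h1.const_mul (M p)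
      · rw [Real.norm_of_nonneg (mul_nonneg (hM0 p) (hd0 N p))]
        exact mul_le_of_le_one_right (hM0 p) (hd1 N p)
    simpa using h.add he₁
  · filter_upwards [hlast] with N hN t ht
    have ht1 : t ∈ Set.Ico (0 : ℝ) 1 := ⟨ht.1, ht.2.trans_lt hb⟩
    set q := t * Real.exp (-t) with hq
    have hq0 : 0 ≤ q := mul_nonneg ht.1 (Real.exp_pos _).le
    have hqb : q ≤ b * Real.exp (-b) := mul_exp_neg_le ht.2 hb0 hb.le
    set γ : ℕ → ℝ := fun p => if p < N then Gn P X (N - p) t else 0 with hγ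
    have hsum : ∑ p ∈ Finset.range N, c (p + 1) * t ^ p * Real.exp (-((p + 1) * t)) *
        Gn P X (N - p) t = ∑' p, c (p + 1) * q ^ p * Real.exp (-t) * γ p := by
      rw [tsum_eq_sum (s := Finset.range N) fun p hp => by
        rw [Finset.mem_range] at hp; simp [hγ, hp]]
      refine Finset.sum_congr rfl fun p hp => ?_
      rw [Finset.mem_range] at hp
      simp only [hγ, hp, if_true, hq]
      rw [mul_pow, ← Real.exp_nat_mul, show -(((p : ℝ) + 1) * t) = p * -t + -t by ring,
        Real.exp_add]
      ring
    have hG1 : G P X t ∈ Set.Icc (0 : ℝ) 1 := ⟨measureReal_nonneg, measureReal_le_one⟩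
    have hrhs : rhs P X t = -∑' p, c (p + 1) * q ^ p * Real.exp (-t) * G P X t := by
      rw [rhs, tsum_mul_right, tsum_mul_right]; ring
    have hs := summable_c_mul_exp ht1
    have hsG : Summable fun p => c (p + 1) * q ^ p * Real.exp (-t) * G P X t :=
      (hs.mul_right _).mul_right _
    have hsγ : Summable fun p => c (p + 1) * q ^ p * Real.exp (-t) * γ p :=
      summable_of_hasFiniteSupport ((Finset.range N).finite_toSet.subset fun p hp => by
        by_contra hcon
        simp only [Finset.coe_range, Set.mem_Iio] at hcon
        exact hp (by simp [hγ, hcon]))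
    have hdiff : -negDeriv P X N t - rhs P X t =
        ∑' p, c (p + 1) * q ^ p * Real.exp (-t) * (G P X t - γ p) - lastDensity N t := by
      rw [negDeriv, hsum, hrhs]
      have : ∑' p, c (p + 1) * q ^ p * Real.exp (-t) * (G P X t - γ p) =
          ∑' p, c (p + 1) * q ^ p * Real.exp (-t) * G P X t -
            ∑' p, c (p + 1) * q ^ p * Real.exp (-t) * γ p := by
        rw [← hsG.tsum_sub hsγ]
        exact tsum_congr fun p => by ring
      rw [this]; ring
    rw [hdiff]
    refine (abs_sub _ _).trans (add_le_add ?_ ?_)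
    · rw [← Real.norm_eq_abs]
      refine tsum_of_norm_bounded (hMd N).hasSum fun p => ?_
      have he : Real.exp (-t) ≤ 1 := by simpa using ht.1
      have hcp := (c_pos p).le
      have hGγ : |G P X t - γ p| ≤ d N p := by
        simp only [hγ, hd]
        split_ifs
        · rw [abs_sub_comm]; exact abs_Gn_sub_G_le hX ht.2 _
        · rw [sub_zero, abs_of_nonneg hG1.1]; exact hG1.2
      rw [norm_mul, Real.norm_of_nonneg (by positivity), Real.norm_eq_abs]
      refine mul_le_mul ?_ hGγ (abs_nonneg _) (hM0 p)
      calc c (p + 1) * q ^ p * Real.exp (-t) ≤ c (p + 1) * q ^ p :=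
            mul_le_of_le_one_right (by positivity) he
        _ ≤ c (p + 1) * (b * Real.exp (-b)) ^ p := by gcongr
    · rw [abs_of_nonneg (lastDensity_nonneg N ht.1)]
      exact hN t ht

theorem tendstoUniformlyOn_negDeriv [IsProbabilityMeasure P] (hX : ∀ i, Measurable (X i))
    (hlaw : ∀ i, HasLaw (X i) (expMeasure 1) P) (hindep : iIndepFun X P) {b : ℝ} (hb0 : 0 < b)
    (hb : b < 1) :
    TendstoUniformlyOn (fun N t => -negDeriv P X N t) (rhs P X) atTop (Set.Icc 0 b) := by
  obtain ⟨e, he, hbound⟩ := exists_bound_negDeriv hX hlaw hindep hb0 hb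
  rw [Metric.tendstoUniformlyOn_iff]
  intro ε hε
  filter_upwards [hbound, he.eventually_lt_const hε] with N hN hlt t ht
  rw [dist_comm, Real.dist_eq]
  exact (hN t ht).trans_lt hlt

theorem continuousOn_rhs_Icc [IsProbabilityMeasure P] (hX : ∀ i, Measurable (X i))
    (hlaw : ∀ i, HasLaw (X i) (expMeasure 1) P) (hindep : iIndepFun X P) {b : ℝ} (hb0 : 0 < b)
    (hb : b < 1) : ContinuousOn (rhs P X) (Set.Icc 0 b) :=
  (tendstoUniformlyOn_negDeriv hX hlaw hindep hb0 hb).continuousOn <|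
    Frequently.of_forall fun N =>
      (continuousOn_negDeriv hX hlaw hindep N).neg.mono Set.Icc_subset_Ici_self

/-- Limit of the integral equations for $G_{N+1}$. Integrability of the limit integrand comes from
uniform convergence of continuous functions, so continuity of $G$ is not presupposed. -/
theorem G_eq_integral [IsProbabilityMeasure P] (hX : ∀ i, Measurable (X i))
    (hlaw : ∀ i, HasLaw (X i) (expMeasure 1) P) (hindep : iIndepFun X P) {b : ℝ} (hb0 : 0 < b)
    (hb : b < 1) {t : ℝ} (ht : t ∈ Set.Icc 0 b) :
    G P X t = 1 + ∫ s in 0..t, rhs P X s := by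
  have hG : Tendsto (fun N => Gn P X (N + 1) t) atTop (𝓝 (G P X t)) := by
    rw [tendsto_iff_norm_sub_tendsto_zero]
    refine squeeze_zero (fun _ => norm_nonneg _) (fun N => abs_Gn_sub_G_le hX ht.2 _)
      ((tendsto_add_atTop_iff_nat 1).2 (tendsto_tailProb hX hlaw hindep hb))
  obtain ⟨e, he, hbound⟩ := exists_bound_negDeriv hX hlaw hindep hb0 hb
  refine tendsto_nhds_unique hG ?_
  rw [tendsto_iff_norm_sub_tendsto_zero]
  have he' : Tendsto (fun N => e N * |t - 0|) atTop (𝓝 0) := by simpa using he.mul_const |t - 0|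
  refine squeeze_zero' (Eventually.of_forall fun _ => norm_nonneg _) ?_ he'
  filter_upwards [hbound] with N hN
  have hsub : Set.uIcc 0 t ⊆ Set.Icc 0 b := by
    rw [Set.uIcc_of_le ht.1]; exact Set.Icc_subset_Icc_right ht.2
  have h1 : IntervalIntegrable (negDeriv P X N) volume 0 t :=
    ((continuousOn_negDeriv hX hlaw hindep N).mono
      (hsub.trans Set.Icc_subset_Ici_self)).intervalIntegrable
  have h2 : IntervalIntegrable (rhs P X) volume 0 t :=
    ((continuousOn_rhs_Icc hX hlaw hindep hb0 hb).mono hsub).intervalIntegrable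
  have heq : Gn P X (N + 1) t - (1 + ∫ s in 0..t, rhs P X s) =
      ∫ s in 0..t, (-negDeriv P X N s - rhs P X s) := by
    rw [Gn_succ_eq hX hlaw hindep N (fun m _ => continuousOn_Gn hX hlaw hindep m) ht.1,
      intervalIntegral.integral_sub (f := fun s => -negDeriv P X N s) h1.neg h2,
      intervalIntegral.integral_neg]
    ring
  rw [heq]
  refine intervalIntegral.norm_integral_le_of_norm_le_const fun s hs => ?_
  exact hN s (hsub (Set.uIoc_subset_uIcc hs))

theorem Icc_mem_nhdsWithin_Ico {t : ℝ} (ht : t ∈ Set.Ico (0 : ℝ) 1) :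
    Set.Icc 0 ((1 + t) / 2) ∈ 𝓝[Set.Ico 0 1] t := by
  have h1 : Set.Iic ((1 + t) / 2) ∈ 𝓝 t := Iic_mem_nhds (by linarith [ht.2])
  filter_upwards [self_mem_nhdsWithin, mem_nhdsWithin_of_mem_nhds h1] with s hs hs'
  exact ⟨hs.1, hs'⟩

theorem continuousOn_rhs [IsProbabilityMeasure P] (hX : ∀ i, Measurable (X i))
    (hlaw : ∀ i, HasLaw (X i) (expMeasure 1) P) (hindep : iIndepFun X P) :
    ContinuousOn (rhs P X) (Set.Ico 0 1) := fun t ht =>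
  (continuousOn_rhs_Icc hX hlaw hindep (b := (1 + t) / 2) (by linarith [ht.1])
    (by linarith [ht.2]) t ⟨ht.1, by linarith [ht.2]⟩).mono_of_mem_nhdsWithin
      (Icc_mem_nhdsWithin_Ico ht)

theorem hasDerivWithinAt_G [IsProbabilityMeasure P] (hX : ∀ i, Measurable (X i))
    (hlaw : ∀ i, HasLaw (X i) (expMeasure 1) P) (hindep : iIndepFun X P) {t : ℝ}
    (ht : t ∈ Set.Ico (0 : ℝ) 1) :
    HasDerivWithinAt (G P X) (rhs P X t) (Set.Ico 0 1) t := by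
  have hb0 : 0 < (1 + t) / 2 := by linarith [ht.1]
  have hb : (1 + t) / 2 < 1 := by linarith [ht.2]
  exact (hasDerivWithinAt_of_eq_integral hb0.le (continuousOn_rhs_Icc hX hlaw hindep hb0 hb)
    (fun s hs => G_eq_integral hX hlaw hindep hb0 hb hs)
    ⟨ht.1, by linarith [ht.2]⟩).mono_of_mem_nhdsWithin (Icc_mem_nhdsWithin_Ico ht)

/-- A law only provides almost everywhere measurability; this permits replacing the increments by
measurable versions. -/
theorem Gn_congr {X X' : ℕ → Ω → ℝ} (h : ∀ i, X i =ᵐ[P] X' i) (n : ℕ) : Gn P X n = Gn P X' n := by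
  funext t
  refine measureReal_congr ?_
  filter_upwards [ae_all_iff.2 h] with ω hω
  simp only [Set.ofPred, Y_congr hω]

theorem G_congr {X X' : ℕ → Ω → ℝ} (h : ∀ i, X i =ᵐ[P] X' i) : G P X = G P X' := by
  funext t
  refine measureReal_congr ?_
  filter_upwards [ae_all_iff.2 h] with ω hω
  simp only [Set.ofPred, Y_congr hω]

end

end

end ExpArea

/-- `X 0, X 1, ...` are i.i.d. standard exponential. At the left end point `0` all derivatives
are one-sided; `0 < c k` includes that the polytope has finite volume. -/
theorem proposition2 {Ω : Type*} [MeasurableSpace Ω] (P : Measure Ω) [IsProbabilityMeasure P]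
    (X : ℕ → Ω → ℝ) (hlaw : ∀ i, HasLaw (X i) (expMeasure 1) P) (hindep : iIndepFun X P) :
    (∀ k, 1 ≤ k → 0 < ExpArea.c k) ∧
    (ExpArea.c =O[atTop] fun k : ℕ => Real.sqrt k * Real.exp k) ∧
    (∀ n, 1 ≤ n → ContDiffOn ℝ 1 (ExpArea.Gn P X n) (Set.Ici 0)) ∧
    (∀ t ∈ Set.Ico (0 : ℝ) 1,
      Summable fun k : ℕ => ExpArea.c (k + 1) * (t * Real.exp (-t)) ^ k) ∧
    (∀ ε ∈ Set.Ioo (0 : ℝ) 1,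
      TendstoUniformlyOn (fun n t => derivWithin (ExpArea.Gn P X n) (Set.Ici 0) t)
        (ExpArea.rhs P X) atTop (Set.Icc 0 (1 - ε))) ∧
    ContDiffOn ℝ 1 (ExpArea.G P X) (Set.Ico 0 1) ∧
    (∀ t ∈ Set.Ico (0 : ℝ) 1,
      HasDerivWithinAt (ExpArea.G P X) (ExpArea.rhs P X t) (Set.Ico 0 1) t) := by
  have hmk : ∀ i, X i =ᵐ[P] (hlaw i).aemeasurable.mk (X i) := fun i =>
    (hlaw i).aemeasurable.ae_eq_mk
  set X' : ℕ → Ω → ℝ := fun i => (hlaw i).aemeasurable.mk (X i)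
  have hX : ∀ i, Measurable (X' i) := fun i => (hlaw i).aemeasurable.measurable_mk
  have hlaw' : ∀ i, HasLaw (X' i) (expMeasure 1) P := fun i => (hlaw i).congr (hmk i).symm
  have hindep' : iIndepFun X' P := hindep.congr hmk
  have hrhs : ExpArea.rhs P X = ExpArea.rhs P X' := by
    funext t
    rw [ExpArea.rhs, ExpArea.rhs, ExpArea.G_congr hmk]
  simp only [ExpArea.Gn_congr hmk, ExpArea.G_congr hmk, hrhs]
  refine ⟨fun k hk => ?_, ExpArea.c_isBigO, fun n hn => ?_, fun t ht =>
    ExpArea.summable_c_mul_exp ht, fun ε hε => ?_, ?_, fun t ht =>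
    ExpArea.hasDerivWithinAt_G hX hlaw' hindep' ht⟩
  · obtain ⟨p, rfl⟩ : ∃ p, k = p + 1 := ⟨k - 1, by omega⟩
    exact ExpArea.c_pos p
  · obtain ⟨N, rfl⟩ : ∃ N, n = N + 1 := ⟨n - 1, by omega⟩
    exact ExpArea.contDiffOn_one_of_hasDerivWithinAt (uniqueDiffOn_Ici 0)
      (ExpArea.continuousOn_negDeriv hX hlaw' hindep' N).neg
      fun t ht => ExpArea.hasDerivWithinAt_Gn hX hlaw' hindep' N ht
  · have h := ExpArea.tendstoUniformlyOn_negDeriv hX hlaw' hindep' (sub_pos.2 hε.2)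
      (sub_lt_self 1 hε.1)
    rw [Metric.tendstoUniformlyOn_iff] at h ⊢
    intro δ hδ
    -- `negDeriv P X N` belongs to $G_{N+1}$, so the threshold moves up by one.
    obtain ⟨N₀, hN₀⟩ := eventually_atTop.1 (h δ hδ)
    refine eventually_atTop.2 ⟨N₀ + 1, fun n hn t ht => ?_⟩
    obtain ⟨N, rfl⟩ : ∃ N, n = N + 1 := ⟨n - 1, by omega⟩
    rw [(ExpArea.hasDerivWithinAt_Gn hX hlaw' hindep' N ht.1).derivWithin
      (uniqueDiffOn_Ici 0 t ht.1)]
    exact hN₀ N (by omega) t ht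
  · exact ExpArea.contDiffOn_one_of_hasDerivWithinAt (uniqueDiffOn_Ico 0 1)
      (ExpArea.continuousOn_rhs hX hlaw' hindep')
      fun t ht => ExpArea.hasDerivWithinAt_G hX hlaw' hindep' ht
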